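/- Let $X=[\underline x,\overline x]$ and $Y=[\underline y,\overline y]$ with $\underline x<\overline x$, $\underline y<\overline y$, and let $F$ and $G$ be cdfs on $X$ (firm types) and $Y$ (worker skills) with continuous, strictly positive densities. Let $v:X\times Y\to\mathbb R$ be twice continuously differentiable with $v_{xz}>0>v_{zz}$ on $X\times Y$; $v(x,z)$ is the value generated by a firm of type $x$ that hires a unit mass of workers of mean skill $z$. An assignment is a probability distribution $J$ on $X\times Y$ whose first marginal is $F$ and whose second marginal, with cdf $H$, satisfies $\int_{\underline y}^{y}H\le\int_{\underline y}^{y}G$ for all $y\in Y$, with equality at $y=\overline y$. A competitive equilibrium is an assignment $J$ together with Lipschitz functions $p:X\to\mathbb R$, $q:Y\to\mathbb R$ such that $q$ is convex, $p(x)+q(z)\ge v(x,z)$ on $X\times Y$ with equality on $\operatorname{supp}(J)$, and $\int q\,dH=\int q\,dG$. The corresponding equilibrium matching is the quantile matching function $T=H^{-1}\circ F:X\to Y$, where $H^{-1}(t)=\min\{z\in Y:H(z)\ge t\}$ for $t\in(0,1]$ and $H^{-1}(0)=\lim_{t\downarrow0}H^{-1}(t)$. Let $S=G^{-1}\circ F$.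 For a matching $T$ put $$X^S=\Big\{x\in X:\int_{\underline x}^{x}T\,dF=\int_{\underline x}^{x}S\,dF\Big\},\qquad X^C=\Big\{x\in X:\int_{\underline x}^{x}T\,dF>\int_{\underline x}^{x}S\,dF\Big\}.$$ Call $T$ PAS (positive assortative segregation) if $X^S=X$; full compression if $X^C=(\underline x,\overline x)$; upper compression if $X^C=(x^*,\overline x)$ for some $x^*\in X$; lower compression if $X^C=(\underline x,x^*)$ for some $x^*\in X$ (the intervals may be empty). Theorem. There is exactly one equilibrium matching $T$, and it is: 1. PAS if and only if $x\mapsto v_z(x,S(x))$ is (weakly) increasing on $X$; 2. full compression if $x\mapsto v_z(x,S(x))$ is strictly decreasing on $X$; 3. upper compression if $x\mapsto v_z(x,S(x))$ is strictly quasiconcave on $X$; 4. lower compression if $x\mapsto v_z(x,S(x))$ is strictly quasiconvex on $X$. Here $h$ is strictly quasiconcave on $X$ if $h(b)>\min\{h(a),h(c)\}$ whenever $a<b<c$ in $X$, and strictly quasiconvex if $-h$ is strictly quasiconcave. -/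

import Mathlib

open MeasureTheory Set

noncomputable section

namespace PeerMatching

/-- The law on `ℝ` with density `f` on the interval `[a, b]`. -/
def densityLaw (a b : ℝ) (f : ℝ → ℝ) : Measure ℝ :=
  (volume.restrict (Icc a b)).withDensity (fun t => ENNReal.ofReal (f t))

/-- `f` is a continuous, strictly positive probability density on `[a, b]`. -/
def IsPosContDensity (a b : ℝ) (f : ℝ → ℝ) : Prop :=
  ContinuousOn f (Icc a b) ∧ (∀ t ∈ Icc a b, 0 < f t) ∧ ∫ t in a..b, f t = 1

/-- The distribution function of `ρ`. -/
def distFun (ρ : Measure ℝ) (t : ℝ) : ℝ := ρ.real (Iic t)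

/-- Majorization `H ≽ G` for laws `η` (cdf `H`) and `ν` (cdf `G`) on `[yl, yh]`. -/
def Majorizes (yl yh : ℝ) (η ν : Measure ℝ) : Prop :=
  (∀ y ∈ Icc yl yh, ∫ t in yl..y, distFun η t ≤ ∫ t in yl..y, distFun ν t) ∧
    ∫ t in yl..yh, distFun η t = ∫ t in yl..yh, distFun ν t

/-- An assignment: a law of pairs (firm type, workforce mean) on `[xl, xh] × [yl, yh]` whose
first marginal is the firm distribution `μ` and whose second marginal majorizes the worker
distribution `ν`. -/
structure IsAssignment (xl xh yl yh : ℝ) (μ ν : Measure ℝ) (J : Measure (ℝ × ℝ)) : Prop where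
  isProbability : IsProbabilityMeasure J
  concentrated : J (Icc xl xh ×ˢ Icc yl yh)ᶜ = 0
  fst_eq : J.fst = μ
  majorizes : Majorizes yl yh J.snd ν

/-- Competitive equilibrium `(J; p, q)` for the value function `v x z` (firm type `x`, mean
skill `z`). Only the values of `p` on `[xl, xh]`, of `q` on `[yl, yh]` and of `v` on the product
of the two intervals matter. -/
structure IsCompetitiveEquilibrium (xl xh yl yh : ℝ) (μ ν : Measure ℝ) (v : ℝ → ℝ → ℝ)
    (J : Measure (ℝ × ℝ)) (p q : ℝ → ℝ) : Prop where
  assignment : IsAssignment xl xh yl yh μ ν J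
  lipschitz_p : ∃ K, LipschitzOnWith K p (Icc xl xh)
  lipschitz_q : ∃ K, LipschitzOnWith K q (Icc yl yh)
  eq_on_support : ∀ w ∈ J.support, p w.1 + q w.2 = v w.1 w.2
  no_entry : ∀ x ∈ Icc xl xh, ∀ z ∈ Icc yl yh, v x z ≤ p x + q z
  convex_q : ConvexOn ℝ (Icc yl yh) q
  wage_bill : ∫ z, q z ∂J.snd = ∫ z, q z ∂ν

/-- The quantile matching function `H⁻¹ ∘ F` from the law `μ` (cdf `F`) to the law `η` (cdf `H`) on
`[yl, yh]`, with the generalized inverse `H⁻¹ t = min {z | t ≤ H z}` for `t > 0`, and with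
`H⁻¹ 0` the right limit at `0`, i.e. the bottom of the support. -/
def quantileMatching (yl yh : ℝ) (μ η : Measure ℝ) (x : ℝ) : ℝ :=
  sInf {z ∈ Icc yl yh | distFun μ x ≤ distFun η z ∧ 0 < distFun η z}

/-- `T` is, on `[xl, xh]`, the quantile matching function from the firm distribution to the
distribution of workforce means of a competitive equilibrium. -/
def IsEquilibriumMatching (xl xh yl yh : ℝ) (μ ν : Measure ℝ) (v : ℝ → ℝ → ℝ)
    (T : ℝ → ℝ) : Prop :=
  ∃ (J : Measure (ℝ × ℝ)) (p q : ℝ → ℝ),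
    IsCompetitiveEquilibrium xl xh yl yh μ ν v J p q ∧
      EqOn T (quantileMatching yl yh μ J.snd) (Icc xl xh)

/-- The segregation set `X^S` of a matching `T`, relative to the matching `S`. -/
def segregationSet (xl xh : ℝ) (μ : Measure ℝ) (S T : ℝ → ℝ) : Set ℝ :=
  {x ∈ Icc xl xh | ∫ t in Icc xl x, T t ∂μ = ∫ t in Icc xl x, S t ∂μ}

/-- The compression set `X^C` of a matching `T`, relative to the matching `S`. -/
def compressionSet (xl xh : ℝ) (μ : Measure ℝ) (S T : ℝ → ℝ) : Set ℝ :=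
  {x ∈ Icc xl xh | ∫ t in Icc xl x, S t ∂μ < ∫ t in Icc xl x, T t ∂μ}

def IsPAS (xl xh : ℝ) (μ : Measure ℝ) (S T : ℝ → ℝ) : Prop :=
  segregationSet xl xh μ S T = Icc xl xh

def IsFullCompression (xl xh : ℝ) (μ : Measure ℝ) (S T : ℝ → ℝ) : Prop :=
  compressionSet xl xh μ S T = Ioo xl xh

def IsUpperCompression (xl xh : ℝ) (μ : Measure ℝ) (S T : ℝ → ℝ) : Prop :=
  ∃ c ∈ Icc xl xh, compressionSet xl xh μ S T = Ioo c xh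

def IsLowerCompression (xl xh : ℝ) (μ : Measure ℝ) (S T : ℝ → ℝ) : Prop :=
  ∃ c ∈ Icc xl xh, compressionSet xl xh μ S T = Ioo xl c

/-- `v_z` on `[xl, xh] × [yl, yh]` (one-sided at the ends of `[yl, yh]`). -/
def partialZ (yl yh : ℝ) (v : ℝ → ℝ → ℝ) (x z : ℝ) : ℝ :=
  derivWithin (fun z' => v x z') (Icc yl yh) z

/-- `v_xz`, the derivative of `v_z` in `x`. -/
def partialXZ (xl xh yl yh : ℝ) (v : ℝ → ℝ → ℝ) (x z : ℝ) : ℝ :=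
  derivWithin (fun x' => partialZ yl yh v x' z) (Icc xl xh) x

/-- `v_zz`. -/
def partialZZ (yl yh : ℝ) (v : ℝ → ℝ → ℝ) (x z : ℝ) : ℝ :=
  derivWithin (fun z' => partialZ yl yh v x z') (Icc yl yh) z

def StrictQuasiconcave (s : Set ℝ) (h : ℝ → ℝ) : Prop :=
  ∀ a ∈ s, ∀ b ∈ s, ∀ c ∈ s, a < b → b < c → min (h a) (h c) < h b

def StrictQuasiconvex (s : Set ℝ) (h : ℝ → ℝ) : Prop :=
  ∀ a ∈ s, ∀ b ∈ s, ∀ c ∈ s, a < b → b < c → h b < max (h a) (h c)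

end PeerMatching

end

/-! Write `F`, `G` for the cdfs, `μ`, `ν` for the laws, `m_R x = v_z(x, R x)` for a matching `R`.

Existence is by duality. Minimize the wage bill plus maximal profits, `∫ q dν + ∫ max_z (v x z - q
z) dμ`, over convex wages `q`. Regularization reduces this to `K`-Lipschitz `q` with `q yl = 0`, a
compact class (`exists_dualValue_le`). Since `v x - q` is strictly concave, each firm has a single
best mean `T x`, continuous in `x`, and increasing because `v_xz > 0`. Perturbing the optimal `q` to
`q + ε r` gives `∫ r ∘ T dμ ≤ ∫ r dν` whenever the perturbed wages stay convex
(`integral_comp_demand_le`). Suitable `r` give majorization and the wage-bill equality, so the law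
of `(x, T x)` is an equilibrium assignment (`exists_wages`). For uniqueness, every equilibrium
maximizes `∫ v dJ`. Hence any other one must put its mass where `p + q = v`, which is the graph of
`T`.

For the shape, let `Γ x` be the integral of `T - S` against `F` up to `x`; compression is `Γ > 0`
and segregation is `Γ = 0`. Majorization gives `Γ ≥ 0`, with `Γ = 0` at both ends. As `m_T x` is a
subgradient of `q` at `T x`, the function `m_T` is increasing and `∫ m_T (T - S) dF ≥ ∫ (q ∘ T - q ∘
S) dF = 0`. Integration by parts turns the left side into `-∫ Γ dm_T`, so `m_T` is constant wherever
`Γ > 0` (`IsOptimalMatching.deriv_eq`). At an interior zero of `Γ`, which is a minimum, `T = S`.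

Everything else compares `m_S` with `m_T`, using that `v_z` decreases strictly in `z`: `m_S < m_T`
means `T < S`. If `m_S` is increasing, then `∫ m_S (T - S) dF ≤ 0` and strict monotonicity force `T
= S`. In general, at an interior zero `x₀` of `Γ`, `m_S` cannot lie strictly below `m_S x₀` on all
of `(x₀, xh)`, nor strictly above it on all of `(xl, x₀)` (`exists_right`, `exists_left`). A
strictly decreasing `m_S` therefore allows no interior zero. A strictly quasiconcave one must
increase strictly up to `x₀`, which rules out positive excursions of `Γ` to the left of `x₀`; the
quasiconvex case is the mirror image. -/

namespace PeerMatching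

/-! ### Laws with a positive continuous density and their distribution functions. -/

section DensityLaw

variable {a b : ℝ} {f : ℝ → ℝ}

lemma densityLaw_compl_Icc : densityLaw a b f (Icc a b)ᶜ = 0 := by
  apply withDensity_absolutelyContinuous
  rw [Measure.restrict_apply measurableSet_Icc.compl]
  simp

lemma ae_mem_densityLaw : ∀ᵐ t ∂densityLaw a b f, t ∈ Icc a b :=
  densityLaw_compl_Icc

lemma densityLaw_restrict_Icc : (densityLaw a b f).restrict (Icc a b) = densityLaw a b f :=
  Measure.restrict_eq_self_of_ae_mem ae_mem_densityLaw

instance : NullSingletonClass (densityLaw a b f) := by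
  unfold densityLaw
  infer_instance

lemma IsPosContDensity.isProbabilityMeasure (hf : IsPosContDensity a b f) (hab : a < b) :
    IsProbabilityMeasure (densityLaw a b f) := by
  refine ⟨?_⟩
  have hi : IntegrableOn f (Icc a b) := hf.1.integrableOn_compact isCompact_Icc
  rw [densityLaw, withDensity_apply _ MeasurableSet.univ, Measure.restrict_univ,
    ← ofReal_integral_eq_lintegral_ofReal hi, integral_Icc_eq_integral_Ioc,
    ← intervalIntegral.integral_of_le hab.le, hf.2.2, ENNReal.ofReal_one]
  filter_upwards [ae_restrict_mem measurableSet_Icc] with t ht using (hf.2.1 t ht).le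

lemma IsPosContDensity.setIntegral (hf : IsPosContDensity a b f) (φ : ℝ → ℝ) {s : Set ℝ}
    (hs : MeasurableSet s) :
    ∫ t in s, φ t ∂densityLaw a b f = ∫ t in s ∩ Icc a b, f t * φ t := by
  have hm : AEMeasurable f (volume.restrict (s ∩ Icc a b)) :=
    (hf.1.aemeasurable measurableSet_Icc).mono_measure
      (Measure.restrict_mono inter_subset_right le_rfl)
  rw [densityLaw, restrict_withDensity hs, Measure.restrict_restrict hs,
    integral_withDensity_eq_integral_toReal_smul₀ hm.ennreal_ofReal
      (Filter.Eventually.of_forall fun _ => ENNReal.ofReal_lt_top)]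
  refine setIntegral_congr_fun (hs.inter measurableSet_Icc) fun t ht => ?_
  simp [ENNReal.toReal_ofReal (hf.2.1 t ht.2).le]

lemma IsPosContDensity.setIntegral_Ioc (hf : IsPosContDensity a b f) (φ : ℝ → ℝ) {c d : ℝ}
    (hc : a ≤ c) (hcd : c ≤ d) (hd : d ≤ b) :
    ∫ t in Ioc c d, φ t ∂densityLaw a b f = ∫ t in c..d, f t * φ t := by
  rw [hf.setIntegral φ measurableSet_Ioc, inter_eq_left.2, intervalIntegral.integral_of_le hcd]
  exact fun t ht => ⟨hc.trans ht.1.le, ht.2.trans hd⟩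

lemma IsPosContDensity.setIntegral_pos (hf : IsPosContDensity a b f) {φ : ℝ → ℝ}
    (hφ : ContinuousOn φ (Icc a b)) {c d : ℝ}
    (hc : a ≤ c) (hcd : c < d) (hd : d ≤ b) (hpos : ∀ t ∈ Ioo c d, 0 < φ t) :
    0 < ∫ t in Ioc c d, φ t ∂densityLaw a b f := by
  rw [hf.setIntegral_Ioc φ hc hcd.le hd]
  have hsub : Icc c d ⊆ Icc a b := Icc_subset_Icc hc hd
  refine intervalIntegral.intervalIntegral_pos_of_pos_on ?_ (fun t ht => ?_) hcd
  · exact ((hf.1.mul hφ).mono hsub).intervalIntegrable_of_Icc hcd.le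
  · exact mul_pos (hf.2.1 t (hsub (Ioo_subset_Icc_self ht))) (hpos t ht)

lemma integrable_densityLaw [IsFiniteMeasure (densityLaw a b f)] {φ : ℝ → ℝ}
    (hφ : ContinuousOn φ (Icc a b)) :
    Integrable φ (densityLaw a b f) := by
  rw [← densityLaw_restrict_Icc]
  exact hφ.integrableOn_compact isCompact_Icc

lemma measureReal_densityLaw_Ioc_pos (hf : IsPosContDensity a b f) {c d : ℝ}
    (hc : a ≤ c) (hcd : c < d) (hd : d ≤ b) : 0 < (densityLaw a b f).real (Ioc c d) := by
  have := hf.setIntegral_pos (φ := fun _ => 1) continuousOn_const hc hcd hd (fun _ _ => one_pos)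
  simpa using this

lemma distFun_mono (ρ : Measure ℝ) [IsFiniteMeasure ρ] : Monotone (distFun ρ) :=
  fun _ _ h => measureReal_mono (Iic_subset_Iic.2 h)

lemma distFun_nonneg (ρ : Measure ℝ) (t : ℝ) : 0 ≤ distFun ρ t := measureReal_nonneg

lemma distFun_le_one (ρ : Measure ℝ) [IsProbabilityMeasure ρ] (t : ℝ) : distFun ρ t ≤ 1 :=
  measureReal_le_one

lemma distFun_add (ρ : Measure ℝ) [IsFiniteMeasure ρ] {c d : ℝ} (h : c ≤ d) :
    distFun ρ d = distFun ρ c + ρ.real (Ioc c d) := by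
  rw [distFun, distFun, ← Iic_union_Ioc_eq_Iic h, measureReal_union _ measurableSet_Ioc]
  exact (Iic_disjoint_Ioc le_rfl)

lemma continuous_distFun (ρ : Measure ℝ) [IsProbabilityMeasure ρ] [NullSingletonClass ρ] :
    Continuous (distFun ρ) := by
  have hi : ∀ a b : ℝ, IntervalIntegrable (fun _ => (1 : ℝ)) ρ a b := fun a b =>
    (integrable_const _).intervalIntegrable
  have h := intervalIntegral.continuous_primitive hi 0
  have e : distFun ρ = fun x => distFun ρ 0 + ∫ _ in (0 : ℝ)..x, (1 : ℝ) ∂ρ := by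
    funext x
    rcases le_total 0 x with hx | hx
    · rw [intervalIntegral.integral_of_le hx, distFun_add ρ hx]; simp
    · rw [intervalIntegral.integral_of_ge hx, distFun_add ρ hx]; simp
  rw [e]
  exact continuous_const.add h

variable [IsProbabilityMeasure (densityLaw a b f)]

lemma distFun_densityLaw_of_le {t : ℝ} (ht : t ≤ a) : distFun (densityLaw a b f) t = 0 := by
  rw [distFun, measureReal_eq_zero_iff]
  refine measure_mono_null (t := {a} ∪ (Icc a b)ᶜ) (fun s hs => ?_) ?_
  · rcases eq_or_ne s a with h | h
    · exact Or.inl h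
    · exact Or.inr fun h' => h (le_antisymm (le_trans hs ht) h'.1)
  · exact measure_union_null (measure_singleton _) densityLaw_compl_Icc

lemma distFun_densityLaw_of_ge {t : ℝ} (ht : b ≤ t) : distFun (densityLaw a b f) t = 1 := by
  rw [distFun, ← probReal_univ (μ := densityLaw a b f)]
  apply measureReal_congr
  filter_upwards [ae_mem_densityLaw (a := a) (b := b) (f := f)] with s hs
  exact propext ⟨fun _ => trivial, fun _ => le_trans hs.2 ht⟩

lemma strictMonoOn_distFun (hf : IsPosContDensity a b f) :
    StrictMonoOn (distFun (densityLaw a b f)) (Icc a b) := by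
  intro c hc d hd h
  rw [distFun_add _ h.le]
  linarith [measureReal_densityLaw_Ioc_pos hf hc.1 h hd.2]

end DensityLaw

/-! ### Majorization and the convex order. -/

section Majorization

/-- Chebyshev-type inequality: a monotone weight integrates nonpositively against a function of
mean zero whose partial integrals are nonnegative, and the gain is quantified where these are
bounded below. -/
lemma integral_monotone_mul_le {ρ : Measure ℝ} [IsFiniteMeasure ρ] [NullSingletonClass ρ]
    {k φ : ℝ → ℝ} (hk : Monotone k) {α β : ℝ} (hkb : ∀ t, k t ∈ Icc α β)
    (hφ : Integrable φ ρ) (h0 : ∫ t, φ t ∂ρ = 0) (hnn : ∀ c, 0 ≤ ∫ t in Iic c, φ t ∂ρ)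
    {a b σ : ℝ} (hab : a ≤ b) (hσ : ∀ c ∈ Icc a b, σ ≤ ∫ t in Iic c, φ t ∂ρ) :
    ∫ t, k t * φ t ∂ρ ≤ -σ * (k b - k a) := by
  -- Layer cake: `k t - α` is the length of `{s ∈ (α, β] | s < k t}`, so Fubini turns the integral
  -- into an average over `s` of integrals of `φ` over superlevel sets of `k`.
  have hmeas : MeasurableSet {p : ℝ × ℝ | p.2 < k p.1} :=
    measurableSet_lt measurable_snd (hk.measurable.comp measurable_fst)
  have hlt : ∀ s, MeasurableSet {t | s < k t} := fun s => measurableSet_lt measurable_const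
    hk.measurable
  have hint : Integrable (Function.uncurry fun t s => (Iio (k t)).indicator (fun _ => φ t) s)
      (ρ.prod (volume.restrict (Ioc α β))) := by
    have h1 : Integrable (fun p : ℝ × ℝ => φ p.1 * (1 : ℝ))
        (ρ.prod (volume.restrict (Ioc α β))) := hφ.mul_prod (integrable_const _)
    refine (h1.indicator hmeas).congr (Filter.Eventually.of_forall fun p => ?_)
    simp only [Function.uncurry, indicator, mem_ofPred_eq, mul_one, mem_Iio]
  have hinner : ∀ t, ∫ s in Ioc α β, (Iio (k t)).indicator (fun _ => φ t) s
      = k t * φ t - α * φ t := by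
    intro t
    have : Ioc α β ∩ Iio (k t) = Ioo α (k t) := by
      ext s
      constructor
      · rintro ⟨h1, h2⟩
        exact ⟨h1.1, h2⟩
      · rintro ⟨h1, h2⟩
        exact ⟨⟨h1, h2.le.trans (hkb t).2⟩, h2⟩
    rw [setIntegral_indicator measurableSet_Iio, this, setIntegral_const]
    simp [Measure.real, ENNReal.toReal_ofReal (sub_nonneg.2 (hkb t).1), sub_mul]
  have hkφ : Integrable (fun t => k t * φ t) ρ := by
    refine hφ.bdd_mul (c := max |α| |β|) hk.measurable.aestronglyMeasurable
      (Filter.Eventually.of_forall fun t => ?_)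
    exact abs_le_max_abs_abs (hkb t).1 (hkb t).2
  have hswap := integral_integral_swap hint
  simp only [hinner] at hswap
  rw [integral_sub hkφ (hφ.const_mul α), integral_const_mul, h0, mul_zero, sub_zero] at hswap
  rw [hswap]
  have hU : ∀ s, ∫ t, (Iio (k t)).indicator (fun _ => φ t) s ∂ρ = -∫ t in {t | k t ≤ s}, φ t ∂ρ := by
    intro s
    have e : (fun t => (Iio (k t)).indicator (fun _ => φ t) s)
        = {t | s < k t}.indicator φ := by
      funext t; simp [indicator]
    have h2 := integral_add_compl (hlt s) hφ
    have e2 : {t | s < k t}ᶜ = {t | k t ≤ s} := by ext t; simp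
    rw [e, integral_indicator (hlt s)]
    rw [h0, e2] at h2
    linarith
  -- A proper sublevel set of a monotone weight is a half-line up to its endpoint, and the endpoint
  -- is null.
  have hL : ∀ s, (∃ t, k t ≤ s) → (∃ t, s < k t) →
      ∃ c, (∀ t, k t ≤ s → t ≤ c) ∧ (∀ t, s < k t → c ≤ t) ∧
        ∫ t in {t | k t ≤ s}, φ t ∂ρ = ∫ t in Iic c, φ t ∂ρ := by
    rintro s ⟨t0, ht0⟩ ⟨t1, ht1⟩
    have hub : ∀ t, s < k t → ∀ t' ∈ {t | k t ≤ s}, t' ≤ t := fun t ht t' ht' => by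
      by_contra! h
      exact absurd (hk h.le) (not_le.2 (lt_of_le_of_lt ht' ht))
    have hbd : BddAbove {t | k t ≤ s} := ⟨t1, hub t1 ht1⟩
    refine ⟨sSup {t | k t ≤ s}, fun t ht => le_csSup hbd ht,
      fun t ht => csSup_le ⟨t0, ht0⟩ (hub t ht), setIntegral_congr_set ?_⟩
    have hne : ∀ᵐ t ∂ρ, t ≠ sSup {t | k t ≤ s} := by
      simp [ae_iff]
    filter_upwards [hne] with t ht
    refine propext ⟨fun h => le_csSup hbd h, fun h => ?_⟩
    obtain ⟨t', ht', h'⟩ := exists_lt_of_lt_csSup ⟨t0, ht0⟩ (lt_of_le_of_ne h ht)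
    exact (hk h'.le).trans ht'
  have hΨ : ∀ s, ∫ t, (Iio (k t)).indicator (fun _ => φ t) s ∂ρ
      ≤ (Ioo (k a) (k b)).indicator (fun _ => -σ) s := by
    intro s
    rw [hU]
    by_cases hs : s ∈ Ioo (k a) (k b)
    · rw [indicator_of_mem hs]
      obtain ⟨c, hc1, hc2, hc⟩ := hL s ⟨a, hs.1.le⟩ ⟨b, hs.2⟩
      rw [hc]
      exact neg_le_neg (hσ c ⟨hc1 a hs.1.le, hc2 b hs.2⟩)
    · rw [indicator_of_notMem hs, neg_nonpos]
      by_cases h1 : ∃ t, k t ≤ s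
      · by_cases h2 : ∃ t, s < k t
        · obtain ⟨c, -, -, hc⟩ := hL s h1 h2
          rw [hc]
          exact hnn c
        · push Not at h2
          rw [show {t | k t ≤ s} = univ from eq_univ_of_forall h2, setIntegral_univ, h0]
      · push Not at h1
        rw [show {t | k t ≤ s} = ∅ from eq_empty_of_forall_notMem fun t ht =>
          absurd ht (not_le.2 (h1 t)), setIntegral_empty]
  calc ∫ s in Ioc α β, ∫ t, (Iio (k t)).indicator (fun _ => φ t) s ∂ρ
      ≤ ∫ s in Ioc α β, (Ioo (k a) (k b)).indicator (fun _ => -σ) s :=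
        integral_mono hint.swap.integral_prod_left
          ((integrable_const _).indicator measurableSet_Ioo) hΨ
    _ = -σ * (k b - k a) := by
        have : Ioc α β ∩ Ioo (k a) (k b) = Ioo (k a) (k b) := inter_eq_right.2 fun s hs =>
          ⟨(hkb a).1.trans_lt hs.1, hs.2.le.trans (hkb b).2⟩
        rw [setIntegral_indicator measurableSet_Ioo, this, setIntegral_const]
        simp [Measure.real, ENNReal.toReal_ofReal (sub_nonneg.2 (hk hab)), mul_comm]

/-- Fubini, with `distFun ρ t` written as the integral of the indicator of `z ≤ t`. A constant `k`
yields the integrated cdf; for `k` a derivative of `q`, it expresses `∫ q dρ` through the cdf. -/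
lemma intervalIntegral_mul_distFun (ρ : Measure ℝ) [IsProbabilityMeasure ρ] {c y : ℝ}
    (hρ : ∀ᵐ z ∂ρ, c ≤ z) (hcy : c ≤ y) {k : ℝ → ℝ} (hk : IntervalIntegrable k volume c y) :
    ∫ t in c..y, k t * distFun ρ t = ∫ z, (∫ t in (min z y)..y, k t) ∂ρ := by
  have hk' : IntegrableOn k (Ioc c y) := (intervalIntegrable_iff_integrableOn_Ioc_of_le hcy).1 hk
  have hmeas : MeasurableSet {p : ℝ × ℝ | p.1 ≤ p.2} :=
    measurableSet_le measurable_fst measurable_snd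
  have hint : Integrable (Function.uncurry fun z t => (Iic t).indicator (fun _ => k t) z)
      (ρ.prod (volume.restrict (Ioc c y))) := by
    have h1 : Integrable (fun p : ℝ × ℝ => (1 : ℝ) * k p.2)
        (ρ.prod (volume.restrict (Ioc c y))) := (integrable_const (1 : ℝ)).mul_prod hk'
    refine (h1.indicator hmeas).congr (Filter.Eventually.of_forall fun p => ?_)
    simp only [Function.uncurry, indicator, mem_ofPred_eq, one_mul, mem_Iic]
  have hswap := integral_integral_swap hint
  have e1 : ∀ t, ∫ z, (Iic t).indicator (fun _ => k t) z ∂ρ = k t * distFun ρ t := by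
    intro t
    rw [integral_indicator measurableSet_Iic, setIntegral_const, distFun, smul_eq_mul, mul_comm]
  simp only [e1] at hswap
  rw [intervalIntegral.integral_of_le hcy, ← hswap]
  refine integral_congr_ae ?_
  filter_upwards [hρ] with z hz
  have e2 : (fun t => (Iic t).indicator (fun _ => k t) z) = (Ici z).indicator k := by
    funext t; simp [indicator]
  rw [e2, setIntegral_indicator measurableSet_Ici, intervalIntegral.integral_of_le (min_le_right _ _)]
  refine setIntegral_congr_set ?_
  have hne : ∀ᵐ t : ℝ, t ≠ z := by simp [ae_iff]
  filter_upwards [hne] with t ht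
  refine propext ⟨fun h => ⟨?_, h.1.2⟩, fun h => ?_⟩
  · exact min_lt_of_left_lt (lt_of_le_of_ne h.2 ht.symm)
  · have h1 : z < t := by
      rcases min_lt_iff.1 h.1 with h' | h'
      · exact h'
      · exact absurd h.2 (not_le.2 h')
    exact ⟨⟨lt_of_le_of_lt hz h1, h.2⟩, h1.le⟩

lemma intervalIntegral_distFun (ρ : Measure ℝ) [IsProbabilityMeasure ρ] {c y : ℝ}
    (hρ : ∀ᵐ z ∂ρ, c ≤ z) (hcy : c ≤ y) :
    ∫ t in c..y, distFun ρ t = ∫ z, (y - min z y) ∂ρ := by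
  have := intervalIntegral_mul_distFun ρ hρ hcy (k := fun _ => 1)
    (intervalIntegrable_const)
  simpa using this

lemma exists_rightDeriv {c d : ℝ} (hcd : c < d) {q : ℝ → ℝ} (hq : ConvexOn ℝ (Icc c d) q)
    {K : NNReal} (hK : LipschitzOnWith K q (Icc c d)) :
    ∃ k : ℝ → ℝ, Monotone k ∧ (∀ t, k t ∈ Icc (-K : ℝ) K) ∧
      ∀ z ∈ Icc c d, ∫ t in z..d, k t = q d - q z := by
  have hd : ∀ x ∈ Ioo c d, DifferentiableWithinAt ℝ q (Ioi x) x := fun x hx =>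
    hq.differentiableWithinAt_Ioi_of_mem_interior (by rwa [interior_Icc])
  have hmono := hq.monotoneOn_rightDeriv
  rw [interior_Icc] at hmono
  set k₀ : ℝ → ℝ := fun x => derivWithin q (Ioi x) x
  have hb : ∀ x ∈ Ioo c d, k₀ x ∈ Icc (-K : ℝ) K := by
    intro x hx
    rw [mem_Icc, ← abs_le]
    have h1 : HasDerivWithinAt q (k₀ x) (Ioo x d) x :=
      ((hd x hx).hasDerivWithinAt).mono Ioo_subset_Ioi_self
    rw [hasDerivWithinAt_iff_tendsto_slope' (by simp)] at h1
    have : (nhdsWithin x (Ioo x d)).NeBot := by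
      rw [nhdsWithin_Ioo_eq_nhdsGT hx.2]; infer_instance
    refine le_of_tendsto h1.abs ?_
    filter_upwards [self_mem_nhdsWithin] with y hy
    have h2 := hK.dist_le_mul y ⟨(hx.1.trans hy.1).le, hy.2.le⟩ x ⟨hx.1.le, hx.2.le⟩
    rw [Real.dist_eq, Real.dist_eq] at h2
    rw [slope_def_field, abs_div, div_le_iff₀ (abs_pos.2 (sub_ne_zero.2 hy.1.ne'))]
    exact h2
  have hKK : (-K : ℝ) ≤ K := by linarith [K.2, show (K : ℝ) = K.1 from rfl]
  -- The extreme slopes `-K` and `K` at and beyond the ends keep `k` monotone and bounded on the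
  -- whole line.
  set k : ℝ → ℝ := fun x => if x ≤ c then -K else if d ≤ x then K else k₀ x with hk
  have hkI : ∀ x ∈ Ioo c d, k x = k₀ x := fun x hx => by
    simp [hk, not_le.2 hx.1, not_le.2 hx.2]
  have hkb : ∀ t, k t ∈ Icc (-K : ℝ) K := by
    intro t
    simp only [hk]
    split_ifs with h1 h2
    · exact ⟨le_rfl, hKK⟩
    · exact ⟨hKK, le_rfl⟩
    · exact hb t ⟨not_le.1 h1, not_le.1 h2⟩
  have hkm : Monotone k := by
    intro s t hst
    by_cases h1 : s ≤ c
    · rw [show k s = -K by simp [hk, h1]]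
      exact (hkb t).1
    by_cases h2 : d ≤ t
    · rw [show k t = K by simp [hk, h2, not_le.2 (hcd.trans_le h2)]]
      exact (hkb s).2
    rw [hkI s ⟨not_le.1 h1, hst.trans_lt (not_le.1 h2)⟩,
      hkI t ⟨(not_le.1 h1).trans_le hst, not_le.1 h2⟩]
    exact hmono ⟨not_le.1 h1, hst.trans_lt (not_le.1 h2)⟩
      ⟨(not_le.1 h1).trans_le hst, not_le.1 h2⟩ hst
  refine ⟨k, hkm, hkb, fun z hz => ?_⟩
  refine intervalIntegral.integral_eq_sub_of_hasDeriv_right_of_le hz.2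
    (hK.continuousOn.mono (Icc_subset_Icc_left hz.1)) (fun x hx => ?_) hkm.intervalIntegrable
  have hx' : x ∈ Ioo c d := ⟨hz.1.trans_lt hx.1, hx.2⟩
  rw [hkI x hx']
  exact (hd x hx').hasDerivWithinAt

/-- Majorization implies the convex order on Lipschitz convex functions. -/
lemma Majorizes.integral_le {c d : ℝ} (hcd : c < d) {η ν : Measure ℝ} [IsProbabilityMeasure η]
    [IsProbabilityMeasure ν] (h : Majorizes c d η ν) (hη : ∀ᵐ z ∂η, z ∈ Icc c d)
    (hν : ∀ᵐ z ∂ν, z ∈ Icc c d) {q : ℝ → ℝ} (hq : ConvexOn ℝ (Icc c d) q)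
    {K : NNReal} (hK : LipschitzOnWith K q (Icc c d)) :
    ∫ z, q z ∂η ≤ ∫ z, q z ∂ν := by
  -- By parts, `∫ q dρ = q d - ∫ k · distFun ρ` with `k` the increasing slope of `q`. The
  -- Chebyshev-type inequality then applies to the difference of the two cdfs, with Lebesgue measure
  -- as base.
  obtain ⟨k, hkm, hkb, hkq⟩ := exists_rightDeriv hcd hq hK
  have key : ∀ ρ : Measure ℝ, IsProbabilityMeasure ρ → (∀ᵐ z ∂ρ, z ∈ Icc c d) →
      ∫ z, q z ∂ρ = q d - ∫ t in c..d, k t * distFun ρ t := by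
    intro ρ _ hρ
    have hi : Integrable q ρ := by
      rw [← Measure.restrict_eq_self_of_ae_mem hρ]
      exact hK.continuousOn.integrableOn_compact isCompact_Icc
    rw [intervalIntegral_mul_distFun ρ (hρ.mono fun z hz => hz.1) hcd.le hkm.intervalIntegrable]
    have : ∫ z, (∫ t in (min z d)..d, k t) ∂ρ = ∫ z, (q d - q z) ∂ρ := by
      refine integral_congr_ae ?_
      filter_upwards [hρ] with z hz
      rw [min_eq_left hz.2, hkq z hz]
    rw [this, integral_sub (integrable_const _) hi]
    simp
  rw [key η inferInstance hη, key ν inferInstance hν]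
  have hi : ∀ (ρ : Measure ℝ) [IsProbabilityMeasure ρ] (a b : ℝ),
      IntervalIntegrable (distFun ρ) volume a b := fun ρ _ a b =>
    (distFun_mono ρ).intervalIntegrable
  have hki : ∀ (ρ : Measure ℝ) [IsProbabilityMeasure ρ],
      IntervalIntegrable (fun t => k t * distFun ρ t) volume c d := by
    intro ρ _
    rw [intervalIntegrable_iff_integrableOn_Ioc_of_le hcd.le]
    have h1 := (intervalIntegrable_iff_integrableOn_Ioc_of_le hcd.le).1 (hi ρ c d)
    refine Integrable.bdd_mul (c := (K : ℝ)) h1 hkm.measurable.aestronglyMeasurable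
      (Filter.Eventually.of_forall fun t => ?_)
    exact abs_le.2 (hkb t)
  have hφ : ∀ a b, IntervalIntegrable (fun t => distFun ν t - distFun η t) volume a b :=
    fun a b => (hi ν a b).sub (hi η a b)
  have hIic : ∀ y ∈ Icc c d, ∫ t in Iic y, (distFun ν t - distFun η t) ∂volume.restrict (Ioc c d)
      = (∫ t in c..y, distFun ν t) - ∫ t in c..y, distFun η t := by
    intro y hy
    rw [← intervalIntegral.integral_sub (hi ν c y) (hi η c y),
      intervalIntegral.integral_of_le hy.1, Measure.restrict_restrict measurableSet_Iic]
    congr 2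
    ext t
    exact ⟨fun h => ⟨h.2.1, h.1⟩, fun h => ⟨h.2, h.1, h.2.trans hy.2⟩⟩
  have h0 : ∫ t, (distFun ν t - distFun η t) ∂volume.restrict (Ioc c d) = 0 := by
    rw [← intervalIntegral.integral_of_le hcd.le,
      intervalIntegral.integral_sub (hi ν c d) (hi η c d), h.2, sub_self]
  have hnn : ∀ y, 0 ≤ ∫ t in Iic y, (distFun ν t - distFun η t) ∂volume.restrict (Ioc c d) := by
    intro y
    rcases le_total y c with h1 | h1
    · rw [Measure.restrict_restrict measurableSet_Iic, show Iic y ∩ Ioc c d = ∅ from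
        eq_empty_of_forall_notMem fun t ht => absurd (le_trans ht.1 h1) (not_le.2 ht.2.1)]
      simp
    rcases le_total d y with h2 | h2
    · rw [Measure.restrict_restrict measurableSet_Iic, inter_eq_right.2
        (show Ioc c d ⊆ Iic y from fun t ht => ht.2.trans h2), h0]
    · rw [hIic y ⟨h1, h2⟩]
      linarith [h.1 y ⟨h1, h2⟩]
  have := integral_monotone_mul_le hkm hkb
    ((intervalIntegrable_iff_integrableOn_Ioc_of_le hcd.le).1 (hφ c d)) h0 hnn
    (le_refl c) (σ := 0) (fun y _ => hnn y)
  rw [← intervalIntegral.integral_of_le hcd.le] at this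
  simp only [mul_sub] at this
  rw [intervalIntegral.integral_sub (hki ν) (hki η)] at this
  linarith

end Majorization

/-! ### Quantile matchings. -/

section Quantile

variable {xl xh yl yh : ℝ} {f g : ℝ → ℝ}

/-- A continuous increasing `T` is recovered from its law. If `z < T x` and `x > xl`, continuity
gives `w < x` with `z < T w`, so the cdf of the law at `z` is at most `F w < F x`, which excludes
`z`. -/
lemma quantileMatching_map [IsProbabilityMeasure (densityLaw xl xh f)]
    (hf : IsPosContDensity xl xh f) (hx : xl < xh) {T : ℝ → ℝ} (hT : Continuous T)
    (hTm : MonotoneOn T (Icc xl xh)) (hTY : ∀ x ∈ Icc xl xh, T x ∈ Icc yl yh)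
    {x : ℝ} (hxX : x ∈ Icc xl xh) :
    quantileMatching yl yh (densityLaw xl xh f) ((densityLaw xl xh f).map T) x = T x := by
  set μ := densityLaw xl xh f
  have hH : ∀ z, distFun (μ.map T) z = μ.real {t | T t ≤ z} := fun z => by
    rw [distFun, map_measureReal_apply hT.measurable measurableSet_Iic]
    rfl
  have hge : ∀ w ∈ Icc xl xh, distFun μ w ≤ distFun (μ.map T) (T w) := by
    intro w hw
    rw [hH, distFun]
    refine ENNReal.toReal_mono (measure_ne_top _ _) (measure_mono_ae ?_)
    filter_upwards [ae_mem_densityLaw (a := xl) (b := xh) (f := f)] with t ht htw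
    exact hTm ht hw htw
  have hle : ∀ w ∈ Icc xl xh, ∀ z, z < T w → distFun (μ.map T) z ≤ distFun μ w := by
    intro w hw z hz
    rw [hH, distFun]
    refine ENNReal.toReal_mono (measure_ne_top _ _) (measure_mono_ae ?_)
    filter_upwards [ae_mem_densityLaw (a := xl) (b := xh) (f := f)] with t ht htz
    by_contra! h
    exact absurd (hTm hw ht (le_of_lt (not_le.1 h))) (not_le.2 (lt_of_le_of_lt htz hz))
  have hF0 : distFun μ xl = 0 := distFun_densityLaw_of_le le_rfl
  have hFm := strictMonoOn_distFun hf
  have hxl : xl ∈ Icc xl xh := left_mem_Icc.2 hx.le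
  have hbound : ∀ z ∈ {z ∈ Icc yl yh | distFun μ x ≤ distFun (μ.map T) z ∧
      0 < distFun (μ.map T) z}, T x ≤ z := by
    rintro z ⟨-, hz1, hz2⟩
    by_contra! h
    rcases eq_or_lt_of_le hxX.1 with he | hlt
    · subst he
      linarith [hle xl hxl z h]
    · obtain ⟨w, hw, hzw⟩ : ∃ w ∈ Ico xl x, z < T w := by
        have h1 : ∀ᶠ w in nhdsWithin x (Iio x), z < T w :=
          nhdsWithin_le_nhds (hT.continuousAt.eventually_const_lt h)
        have h2 : ∀ᶠ w in nhdsWithin x (Iio x), w ∈ Ico xl x := Ico_mem_nhdsLT hlt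
        exact ((h2.and h1).exists)
      have hwX : w ∈ Icc xl xh := ⟨hw.1, hw.2.le.trans hxX.2⟩
      linarith [hle w hwX z hzw, hFm hwX hxX hw.2]
  have hmemlt : ∀ w ∈ Ioc xl xh, x ≤ w → T w ∈ {z ∈ Icc yl yh |
      distFun μ x ≤ distFun (μ.map T) z ∧ 0 < distFun (μ.map T) z} := by
    intro w hw hxw
    have hwX : w ∈ Icc xl xh := Ioc_subset_Icc_self hw
    refine ⟨hTY w hwX, (hFm.monotoneOn hxX hwX hxw).trans (hge w hwX), ?_⟩
    linarith [hFm hxl hwX hw.1, hge w hwX]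
  have hbdd : BddBelow {z ∈ Icc yl yh | distFun μ x ≤ distFun (μ.map T) z ∧
      0 < distFun (μ.map T) z} := ⟨T x, hbound⟩
  refine le_antisymm ?_ (le_csInf ⟨_, hmemlt xh ⟨hx, le_rfl⟩ hxX.2⟩ hbound)
  -- At the lowest firm `T x` itself may have zero cdf and be excluded; it is reached as the limit
  -- of `T w` for `w ↓ xl`.
  refine (eq_or_lt_of_le hxX.1).elim (fun he => ?_)
    fun hlt => csInf_le hbdd (hmemlt x ⟨hlt, hxX.2⟩ le_rfl)
  have hlim : Filter.Tendsto T (nhdsWithin x (Ioi x)) (nhds (T x)) :=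
    hT.continuousAt.tendsto.mono_left nhdsWithin_le_nhds
  refine ge_of_tendsto hlim ?_
  filter_upwards [Ioc_mem_nhdsGT (he ▸ hx : x < xh)] with w hw
  exact csInf_le hbdd (hmemlt w ⟨he ▸ hw.1, hw.2⟩ hw.1.le)

variable [IsProbabilityMeasure (densityLaw xl xh f)] [IsProbabilityMeasure (densityLaw yl yh g)]

lemma quantileMatching_spec (hg : IsPosContDensity yl yh g) (hy : yl < yh) (x : ℝ) :
    quantileMatching yl yh (densityLaw xl xh f) (densityLaw yl yh g) x ∈ Icc yl yh ∧
      distFun (densityLaw yl yh g)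
        (quantileMatching yl yh (densityLaw xl xh f) (densityLaw yl yh g) x)
        = distFun (densityLaw xl xh f) x := by
  set μ := densityLaw xl xh f
  set ν := densityLaw yl yh g
  have hG0 : distFun ν yl = 0 := distFun_densityLaw_of_le le_rfl
  have hG1 : distFun ν yh = 1 := distFun_densityLaw_of_ge le_rfl
  have hGm : StrictMonoOn (distFun ν) (Icc yl yh) := strictMonoOn_distFun hg
  have hyl : yl ∈ Icc yl yh := left_mem_Icc.2 hy.le
  obtain ⟨y, hyY, hyx⟩ : ∃ y ∈ Icc yl yh, distFun ν y = distFun μ x := by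
    have := intermediate_value_Icc hy.le (continuous_distFun ν).continuousOn
    rw [hG0, hG1] at this
    exact this ⟨distFun_nonneg _ _, distFun_le_one _ _⟩
  suffices h : quantileMatching yl yh μ ν x = y by
    rw [h]; exact ⟨hyY, hyx⟩
  unfold quantileMatching
  rw [← hyx]
  rcases eq_or_lt_of_le hyY.1 with he | hlt
  · subst he
    -- The positivity clause removes `yl` but leaves the infimum unchanged.
    have : {z ∈ Icc yl yh | distFun ν yl ≤ distFun ν z ∧ 0 < distFun ν z} = Ioc yl yh := by
      ext z
      constructor
      · rintro ⟨hz, -, hz2⟩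
        refine ⟨lt_of_le_of_ne hz.1 fun h => ?_, hz.2⟩
        rw [← h, hG0] at hz2
        exact lt_irrefl _ hz2
      · intro hz
        have h := hGm hyl (Ioc_subset_Icc_self hz) hz.1
        exact ⟨Ioc_subset_Icc_self hz, h.le, by rwa [hG0] at h⟩
    rw [this, csInf_Ioc hy]
  · have : {z ∈ Icc yl yh | distFun ν y ≤ distFun ν z ∧ 0 < distFun ν z} = Icc y yh := by
      ext z
      constructor
      · rintro ⟨hz, hz1, -⟩
        exact ⟨(hGm.le_iff_le hyY hz).1 hz1, hz.2⟩
      · intro hz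
        have hzY : z ∈ Icc yl yh := ⟨hyY.1.trans hz.1, hz.2⟩
        have h := hGm hyl hyY hlt
        have h' := (hGm.le_iff_le hyY hzY).2 hz.1
        exact ⟨hzY, h', by linarith⟩
    rw [this, csInf_Icc hyY.2]

lemma continuous_quantileMatching (hg : IsPosContDensity yl yh g) (hy : yl < yh) :
    Continuous (quantileMatching yl yh (densityLaw xl xh f) (densityLaw yl yh g)) := by
  have hs := quantileMatching_spec (xl := xl) (xh := xh) (f := f) hg hy
  set S := quantileMatching yl yh (densityLaw xl xh f) (densityLaw yl yh g)
  -- `G` embeds the compact interval topologically, so continuity of `G ∘ S = F` passes to `S`.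
  have hc : Topology.IsClosedEmbedding
      (fun y : Icc yl yh => distFun (densityLaw yl yh g) y) :=
    ((continuous_distFun _).comp continuous_subtype_val).isClosedEmbedding fun a b h =>
      Subtype.ext ((strictMonoOn_distFun hg).injOn a.2 b.2 h)
  have h1 : Continuous (fun x => (⟨S x, (hs x).1⟩ : Icc yl yh)) := by
    rw [hc.isEmbedding.continuous_iff]
    convert continuous_distFun (densityLaw xl xh f) using 1
    funext x
    exact (hs x).2
  exact continuous_subtype_val.comp h1

lemma strictMonoOn_quantileMatching (hf : IsPosContDensity xl xh f)
    (hg : IsPosContDensity yl yh g) (hy : yl < yh) :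
    StrictMonoOn (quantileMatching yl yh (densityLaw xl xh f) (densityLaw yl yh g))
      (Icc xl xh) := by
  intro a ha b hb hab
  obtain ⟨h1, h2⟩ := quantileMatching_spec (xl := xl) (xh := xh) (f := f) hg hy a
  obtain ⟨h3, h4⟩ := quantileMatching_spec (xl := xl) (xh := xh) (f := f) hg hy b
  rw [← (strictMonoOn_distFun hg).lt_iff_lt h1 h3, h2, h4]
  exact strictMonoOn_distFun hf ha hb hab

lemma map_quantileMatching (hf : IsPosContDensity xl xh f) (hg : IsPosContDensity yl yh g)
    (hx : xl < xh) (hy : yl < yh) :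
    (densityLaw xl xh f).map (quantileMatching yl yh (densityLaw xl xh f) (densityLaw yl yh g))
      = densityLaw yl yh g := by
  have hs := quantileMatching_spec (xl := xl) (xh := xh) (f := f) hg hy
  have hSc := continuous_quantileMatching (xl := xl) (xh := xh) (f := f) hg hy
  set μ := densityLaw xl xh f
  set ν := densityLaw yl yh g
  set S := quantileMatching yl yh μ ν
  have := Measure.isProbabilityMeasure_map (μ := μ) hSc.aemeasurable
  refine Measure.ext_of_Iic _ _ fun z => ?_
  rw [← measureReal_eq_measureReal_iff, map_measureReal_apply hSc.measurable measurableSet_Iic]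
  change _ = distFun ν z
  obtain ⟨w, hw, hwz⟩ : ∃ w ∈ Icc xl xh, distFun μ w = distFun ν z := by
    have := intermediate_value_Icc hx.le (continuous_distFun μ).continuousOn
    rw [distFun_densityLaw_of_le le_rfl, distFun_densityLaw_of_ge le_rfl] at this
    exact this ⟨distFun_nonneg _ _, distFun_le_one _ _⟩
  rw [← hwz, distFun]
  have hFm : StrictMonoOn (distFun μ) (Icc xl xh) := strictMonoOn_distFun hf
  refine measureReal_congr ?_
  have hne : ∀ᵐ t ∂μ, t ≠ w := by simp [ae_iff]
  filter_upwards [ae_mem_densityLaw (a := xl) (b := xh) (f := f), hne] with t ht htw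
  refine propext ⟨fun h => ?_, fun h => ?_⟩
  · have h1 : distFun μ t ≤ distFun μ w := by
      rw [← (hs t).2, hwz]
      exact distFun_mono ν h
    exact (hFm.le_iff_le ht hw).1 h1
  · have h1 : distFun μ t < distFun μ w := hFm ht hw (lt_of_le_of_ne h htw)
    rw [hwz, ← (hs t).2] at h1
    change S t ≤ z
    by_contra! h2
    exact absurd (distFun_mono ν h2.le) (not_le.2 h1)

end Quantile

/-! ### Regularity of the value function and the firms' demand. -/

section Value

/-- The first-order and shape properties of a value function with `v_xz > 0 > v_zz`; `d` stands
for `v_z`. -/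
structure IsRegularValue (xl xh yl yh : ℝ) (v d : ℝ → ℝ → ℝ) (K : NNReal) : Prop where
  lipschitz : LipschitzOnWith K (fun w : ℝ × ℝ => v w.1 w.2) (Icc xl xh ×ˢ Icc yl yh)
  strictConcave : ∀ x ∈ Icc xl xh, StrictConcaveOn ℝ (Icc yl yh) (v x)
  strictMono_sub : ∀ x₁ ∈ Icc xl xh, ∀ x₂ ∈ Icc xl xh, x₁ < x₂ →
    StrictMonoOn (fun z => v x₂ z - v x₁ z) (Icc yl yh)
  hasDeriv : ∀ x ∈ Icc xl xh, ∀ z ∈ Icc yl yh, HasDerivWithinAt (v x) (d x z) (Icc yl yh) z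
  continuousOn_deriv : ContinuousOn (fun w : ℝ × ℝ => d w.1 w.2) (Icc xl xh ×ˢ Icc yl yh)
  strictAnti : ∀ x ∈ Icc xl xh, StrictAntiOn (d x) (Icc yl yh)
  strictMono : ∀ z ∈ Icc yl yh, StrictMonoOn (fun x => d x z) (Icc xl xh)

lemma strictMonoOn_of_derivWithin_pos {a b : ℝ} {u : ℝ → ℝ}
    (h : ∀ t ∈ Icc a b, 0 < derivWithin u (Icc a b) t) : StrictMonoOn u (Icc a b) := by
  have hd : ∀ t ∈ Icc a b, DifferentiableWithinAt ℝ u (Icc a b) t := fun t ht => by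
    -- `derivWithin` is zero where the derivative does not exist, so positivity already gives
    -- differentiability.
    by_contra hn
    exact (h t ht).ne' (derivWithin_zero_of_not_differentiableWithinAt hn)
  refine strictMonoOn_of_deriv_pos (convex_Icc a b) (fun t ht => (hd t ht).continuousWithinAt)
    fun t ht => ?_
  rw [← derivWithin_of_mem_nhds (mem_interior_iff_mem_nhds.1 ht)]
  exact h t (interior_subset ht)

lemma exists_isRegularValue {xl xh yl yh : ℝ} (hx : xl < xh) (hy : yl < yh) {v : ℝ → ℝ → ℝ}
    (hv : ContDiffOn ℝ 2 (fun w : ℝ × ℝ => v w.1 w.2) (Icc xl xh ×ˢ Icc yl yh))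
    (hxz : ∀ x ∈ Icc xl xh, ∀ z ∈ Icc yl yh, 0 < partialXZ xl xh yl yh v x z)
    (hzz : ∀ x ∈ Icc xl xh, ∀ z ∈ Icc yl yh, partialZZ yl yh v x z < 0) :
    ∃ K, IsRegularValue xl xh yl yh v (partialZ yl yh v) K := by
  have hconv : Convex ℝ (Icc xl xh ×ˢ Icc yl yh) := (convex_Icc _ _).prod (convex_Icc _ _)
  obtain ⟨K, hK⟩ := hv.exists_lipschitzOnWith (by norm_num) hconv
    (isCompact_Icc.prod isCompact_Icc)
  have hu : UniqueDiffOn ℝ (Icc xl xh ×ˢ Icc yl yh) :=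
    (uniqueDiffOn_Icc hx).prod (uniqueDiffOn_Icc hy)
  have hder : ∀ x ∈ Icc xl xh, ∀ z ∈ Icc yl yh, HasDerivWithinAt (v x)
      (fderivWithin ℝ (fun w : ℝ × ℝ => v w.1 w.2) (Icc xl xh ×ˢ Icc yl yh) (x, z) (0, 1))
      (Icc yl yh) z := by
    intro x hxX z hzY
    have h1 := ((hv.differentiableOn (by norm_num)) (x, z) ⟨hxX, hzY⟩).hasFDerivWithinAt
    have h2 : HasDerivWithinAt (fun z' : ℝ => (x, z')) ((0 : ℝ), (1 : ℝ)) (Icc yl yh) z :=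
      (hasDerivWithinAt_const z _ x).prodMk (hasDerivWithinAt_id z _)
    exact h1.comp_hasDerivWithinAt z h2 fun z' hz' => ⟨hxX, hz'⟩
  -- Identifying `v_z` with a value of the total derivative is what makes it jointly continuous.
  have hpart : ∀ x ∈ Icc xl xh, ∀ z ∈ Icc yl yh, partialZ yl yh v x z =
      fderivWithin ℝ (fun w : ℝ × ℝ => v w.1 w.2) (Icc xl xh ×ˢ Icc yl yh) (x, z) (0, 1) :=
    fun x hxX z hzY => (hder x hxX z hzY).derivWithin (uniqueDiffOn_Icc hy z hzY)
  have hD : ∀ x ∈ Icc xl xh, ∀ z ∈ Icc yl yh,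
      HasDerivWithinAt (v x) (partialZ yl yh v x z) (Icc yl yh) z := fun x hxX z hzY => by
    rw [hpart x hxX z hzY]; exact hder x hxX z hzY
  have hD' : ∀ x ∈ Icc xl xh, ∀ z ∈ interior (Icc yl yh),
      HasDerivAt (v x) (partialZ yl yh v x z) z := fun x hxX z hz =>
    (hD x hxX z (interior_subset hz)).hasDerivAt (mem_interior_iff_mem_nhds.1 hz)
  have hcont : ∀ x ∈ Icc xl xh, ContinuousOn (v x) (Icc yl yh) := fun x hxX z hzY =>
    (hD x hxX z hzY).continuousWithinAt
  have hanti : ∀ x ∈ Icc xl xh, StrictAntiOn (partialZ yl yh v x) (Icc yl yh) := by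
    intro x hxX
    have := strictMonoOn_of_derivWithin_pos (a := yl) (b := yh)
      (u := fun z => -partialZ yl yh v x z) fun z hz => by
        rw [derivWithin.fun_neg]
        exact neg_pos.2 (hzz x hxX z hz)
    intro z hz w hw hzw
    exact neg_lt_neg_iff.1 (this hz hw hzw)
  have hmono : ∀ z ∈ Icc yl yh, StrictMonoOn (fun x => partialZ yl yh v x z) (Icc xl xh) :=
    fun z hz => strictMonoOn_of_derivWithin_pos fun x hxX => hxz x hxX z hz
  refine ⟨K, hK, fun x hxX => ?_, fun x₁ h₁ x₂ h₂ h12 => ?_, hD, ?_, hanti, hmono⟩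
  · refine StrictAntiOn.strictConcaveOn_of_deriv (convex_Icc _ _) (hcont x hxX) ?_
    intro z hz w hw hzw
    rw [(hD' x hxX z hz).deriv, (hD' x hxX w hw).deriv]
    exact hanti x hxX (interior_subset hz) (interior_subset hw) hzw
  · refine strictMonoOn_of_deriv_pos (convex_Icc _ _) ((hcont x₂ h₂).sub (hcont x₁ h₁))
      fun z hz => ?_
    rw [((hD' x₂ h₂ z hz).fun_sub (hD' x₁ h₁ z hz)).deriv]
    exact sub_pos.2 (hmono z (interior_subset hz) h₁ h₂ h12)
  · refine ContinuousOn.congr ?_ fun w hw => hpart w.1 hw.1 w.2 hw.2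
    exact (hv.continuousOn_fderivWithin hu (by norm_num)).clm_apply continuousOn_const

variable {xl xh yl yh : ℝ} {v d : ℝ → ℝ → ℝ} {K : NNReal}

lemma IsRegularValue.abs_sub_le (hr : IsRegularValue xl xh yl yh v d K) {x x' z z' : ℝ}
    (hx : x ∈ Icc xl xh) (hx' : x' ∈ Icc xl xh) (hz : z ∈ Icc yl yh) (hz' : z' ∈ Icc yl yh) :
    |v x z - v x' z'| ≤ K * max |x - x'| |z - z'| := by
  have := hr.lipschitz.dist_le_mul (x, z) ⟨hx, hz⟩ (x', z') ⟨hx', hz'⟩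
  simpa [Real.dist_eq, Prod.dist_eq] using this

lemma IsRegularValue.abs_sub_le_left (hr : IsRegularValue xl xh yl yh v d K) {x x' z : ℝ}
    (hx : x ∈ Icc xl xh) (hx' : x' ∈ Icc xl xh) (hz : z ∈ Icc yl yh) :
    |v x z - v x' z| ≤ K * |x - x'| := by
  simpa using hr.abs_sub_le hx hx' hz hz

lemma IsRegularValue.abs_sub_le_right (hr : IsRegularValue xl xh yl yh v d K) {x z z' : ℝ}
    (hx : x ∈ Icc xl xh) (hz : z ∈ Icc yl yh) (hz' : z' ∈ Icc yl yh) :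
    |v x z - v x z'| ≤ K * |z - z'| := by
  simpa using hr.abs_sub_le hx hx hz hz'

lemma IsRegularValue.continuousOn (hr : IsRegularValue xl xh yl yh v d K) {x : ℝ}
    (hx : x ∈ Icc xl xh) : ContinuousOn (v x) (Icc yl yh) :=
  fun z hz => (hr.hasDeriv x hx z hz).continuousWithinAt

/-- Strict tangent inequality. -/
lemma IsRegularValue.lt_tangent (hr : IsRegularValue xl xh yl yh v d K) {x z w : ℝ}
    (hx : x ∈ Icc xl xh) (hz : z ∈ Icc yl yh) (hw : w ∈ Icc yl yh) (hzw : w ≠ z) :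
    v x w < v x z + d x z * (w - z) := by
  have hder : ∀ s t, s ∈ Icc yl yh → t ∈ Icc yl yh → ∀ c ∈ Ioo s t,
      HasDerivAt (v x) (d x c) c := fun s t hs ht c hc =>
    (hr.hasDeriv x hx c ⟨hs.1.trans hc.1.le, hc.2.le.trans ht.2⟩).hasDerivAt
      (Icc_mem_nhds (hs.1.trans_lt hc.1) (hc.2.trans_le ht.2))
  have hcont : ∀ s t, s ∈ Icc yl yh → t ∈ Icc yl yh → ContinuousOn (v x) (Icc s t) :=
    fun s t hs ht => (hr.continuousOn hx).mono (Icc_subset_Icc hs.1 ht.2)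
  rcases lt_or_gt_of_ne hzw with h | h
  · obtain ⟨c, hc, hcs⟩ := exists_hasDerivAt_eq_slope (v x) (d x) h (hcont w z hw hz)
      (hder w z hw hz)
    have h1 : d x z < d x c :=
      hr.strictAnti x hx ⟨hw.1.trans hc.1.le, hc.2.le.trans hz.2⟩ hz hc.2
    rw [hcs, lt_div_iff₀ (sub_pos.2 h)] at h1
    linarith
  · obtain ⟨c, hc, hcs⟩ := exists_hasDerivAt_eq_slope (v x) (d x) h (hcont z w hz hw)
      (hder z w hz hw)
    have h1 : d x c < d x z :=
      hr.strictAnti x hx hz ⟨hz.1.trans hc.1.le, hc.2.le.trans hw.2⟩ hc.1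
    rw [hcs, div_lt_iff₀ (sub_pos.2 h)] at h1
    linarith

/-- `T x` is a best workforce mean for firm `x` at wages `q`. -/
def IsDemand (xl xh yl yh : ℝ) (v : ℝ → ℝ → ℝ) (q T : ℝ → ℝ) : Prop :=
  ∀ x ∈ Icc xl xh, T x ∈ Icc yl yh ∧ ∀ z ∈ Icc yl yh, v x z - q z ≤ v x (T x) - q (T x)

lemma exists_isDemand (hr : IsRegularValue xl xh yl yh v d K) (hy : yl < yh) {q : ℝ → ℝ}
    (hq : ContinuousOn q (Icc yl yh)) : ∃ T, IsDemand xl xh yl yh v q T := by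
  have : ∀ x, ∃ t, x ∈ Icc xl xh →
      t ∈ Icc yl yh ∧ ∀ z ∈ Icc yl yh, v x z - q z ≤ v x t - q t := by
    intro x
    by_cases hx : x ∈ Icc xl xh
    · obtain ⟨t, ht, hmax⟩ := isCompact_Icc.exists_isMaxOn (nonempty_Icc.2 hy.le)
        ((hr.continuousOn hx).sub hq)
      exact ⟨t, fun _ => ⟨ht, fun z hz => hmax hz⟩⟩
    · exact ⟨0, fun h => absurd h hx⟩
  choose T hT using this
  exact ⟨T, fun x hx => hT x hx⟩

lemma IsDemand.eq (hr : IsRegularValue xl xh yl yh v d K) {q T : ℝ → ℝ}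
    (hT : IsDemand xl xh yl yh v q T) (hq : ConvexOn ℝ (Icc yl yh) q) {x z : ℝ}
    (hx : x ∈ Icc xl xh) (hz : z ∈ Icc yl yh) (h : v x (T x) - q (T x) ≤ v x z - q z) :
    z = T x := by
  have hc : StrictConcaveOn ℝ (Icc yl yh) (v x - q) :=
    (hr.strictConcave x hx).sub_convexOn hq
  refine hc.eq_of_isMaxOn (fun w hw => ?_) (fun w hw => (hT x hx).2 w hw) hz (hT x hx).1
  exact ((hT x hx).2 w hw).trans h

/-- Near-maximizers for nearby objectives are near the unique maximizer. -/
lemma exists_argmax_stability {a b : ℝ} {u : ℝ → ℝ} (hu : ContinuousOn u (Icc a b)) {z₀ : ℝ}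
    (hz₀ : z₀ ∈ Icc a b) (huniq : ∀ z ∈ Icc a b, u z₀ ≤ u z → z = z₀) {ε : ℝ} (hε : 0 < ε) :
    ∃ δ > 0, ∀ (w : ℝ → ℝ), ∀ z ∈ Icc a b, w z₀ ≤ w z →
      (∀ y ∈ Icc a b, |w y - u y| ≤ δ) → |z - z₀| < ε := by
  rcases (Icc a b \ Metric.ball z₀ ε).eq_empty_or_nonempty with he | hne
  · refine ⟨1, one_pos, fun w z hz _ _ => ?_⟩
    have := sdiff_eq_empty.1 he hz
    rwa [Metric.mem_ball, Real.dist_eq] at this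
  · have hcomp : IsCompact (Icc a b \ Metric.ball z₀ ε) := isCompact_Icc.diff Metric.isOpen_ball
    obtain ⟨y, hy, hmax⟩ := hcomp.exists_isMaxOn hne (hu.mono sdiff_subset)
    have hlt : u y < u z₀ := by
      by_contra! h
      have := huniq y hy.1 h
      exact hy.2 (this ▸ Metric.mem_ball_self hε)
    -- Outside the ball `u` is at most `u y`. A perturbation by `δ` shifts a comparison of two
    -- values by at most `2 δ`, less than the gap `3 δ`.
    refine ⟨(u z₀ - u y) / 3, by linarith, fun w z hz hwz hw => ?_⟩
    by_contra! h
    have hzm : z ∈ Icc a b \ Metric.ball z₀ ε := ⟨hz, by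
      rw [Metric.mem_ball, Real.dist_eq]; exact not_lt.2 h⟩
    have h1 : u z ≤ u y := hmax hzm
    have h2 := abs_le.1 (hw z hz)
    have h3 := abs_le.1 (hw z₀ hz₀)
    linarith [h2.2, h3.1]

lemma IsDemand.continuousOn (hr : IsRegularValue xl xh yl yh v d K) {q T : ℝ → ℝ}
    (hT : IsDemand xl xh yl yh v q T) (hq : ConvexOn ℝ (Icc yl yh) q)
    (hqc : ContinuousOn q (Icc yl yh)) : ContinuousOn T (Icc xl xh) := by
  rw [Metric.continuousOn_iff]
  intro x hx ε hε
  obtain ⟨δ, hδ, h⟩ := exists_argmax_stability ((hr.continuousOn hx).sub hqc) (hT x hx).1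
    (fun z hz hle => hT.eq hr hq hx hz hle) hε
  refine ⟨δ / (K + 1), by positivity, fun x' hx' hxx' => ?_⟩
  rw [Real.dist_eq] at hxx' ⊢
  refine h (fun z => v x' z - q z) (T x') (hT x' hx').1 ((hT x' hx').2 _ (hT x hx).1)
    fun y hy => ?_
  rw [lt_div_iff₀ (by positivity)] at hxx'
  have := hr.abs_sub_le_left hx' hx hy
  have h3 : v x' y - q y - (v x - q) y = v x' y - v x y := by
    simp
  rw [h3]
  nlinarith [abs_nonneg (x' - x)]

/-- Revealed preference: if `T` decreased, adding the two firms' optimality inequalities would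
contradict strictly increasing differences. -/
lemma IsDemand.monotoneOn (hr : IsRegularValue xl xh yl yh v d K) {q T : ℝ → ℝ}
    (hT : IsDemand xl xh yl yh v q T) : MonotoneOn T (Icc xl xh) := by
  intro x₁ h₁ x₂ h₂ h12
  rcases eq_or_lt_of_le h12 with rfl | hlt
  · exact le_rfl
  by_contra! h
  have h3 := hr.strictMono_sub x₁ h₁ x₂ h₂ hlt (hT x₂ h₂).1 (hT x₁ h₁).1 h
  have h4 := (hT x₁ h₁).2 _ (hT x₂ h₂).1
  have h5 := (hT x₂ h₂).2 _ (hT x₁ h₁).1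
  simp only at h3
  linarith

lemma IsDemand.tendsto (hr : IsRegularValue xl xh yl yh v d K) {q r T : ℝ → ℝ}
    (hT : IsDemand xl xh yl yh v q T) (hq : ConvexOn ℝ (Icc yl yh) q)
    (hqc : ContinuousOn q (Icc yl yh)) (hrc : ContinuousOn r (Icc yl yh))
    {e : ℕ → ℝ} (he : Filter.Tendsto e Filter.atTop (nhds 0)) {Tn : ℕ → ℝ → ℝ}
    (hTn : ∀ n, IsDemand xl xh yl yh v (fun z => q z + e n * r z) (Tn n)) {x : ℝ}
    (hx : x ∈ Icc xl xh) :
    Filter.Tendsto (fun n => Tn n x) Filter.atTop (nhds (T x)) := by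
  obtain ⟨M, hM⟩ := isCompact_Icc.exists_bound_of_continuousOn hrc
  rw [Metric.tendsto_atTop]
  intro ε hε
  obtain ⟨δ, hδ, h⟩ := exists_argmax_stability ((hr.continuousOn hx).sub hqc) (hT x hx).1
    (fun z hz hle => hT.eq hr hq hx hz hle) hε
  obtain ⟨N, hN⟩ := Metric.tendsto_atTop.1 he (δ / (|M| + 1)) (by positivity)
  refine ⟨N, fun n hn => ?_⟩
  rw [Real.dist_eq]
  refine h (fun z => v x z - (q z + e n * r z)) _ (hTn n x hx).1
    ((hTn n x hx).2 _ (hT x hx).1) fun y hy => ?_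
  have h1 := hN n hn
  rw [Real.dist_eq, sub_zero, lt_div_iff₀ (by positivity)] at h1
  have h2 : v x y - (q y + e n * r y) - (v x - q) y = -(e n * r y) := by
    simp
  rw [h2, abs_neg, abs_mul]
  have h3 : |r y| ≤ |M| + 1 := by
    have := hM y hy
    rw [Real.norm_eq_abs] at this
    linarith [le_abs_self M]
  nlinarith [abs_nonneg (e n)]

end Value

/-! ### The dual problem for wages. -/

section Dual

variable {xl xh yl yh : ℝ} {v d : ℝ → ℝ → ℝ} {K : NNReal}

lemma integrable_of_continuousOn_Icc {ρ : Measure ℝ} [IsFiniteMeasure ρ] {a b : ℝ}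
    (hρ : ∀ᵐ t ∂ρ, t ∈ Icc a b) {φ : ℝ → ℝ} (hφ : ContinuousOn φ (Icc a b)) :
    Integrable φ ρ := by
  rw [← Measure.restrict_eq_self_of_ae_mem hρ]
  exact hφ.integrableOn_compact isCompact_Icc

/-- Wage bill plus profits when the firms demand `T` at wages `q`. -/
noncomputable def dualValue (μ ν : Measure ℝ) (v : ℝ → ℝ → ℝ) (q T : ℝ → ℝ) : ℝ :=
  ∫ z, q z ∂ν + ∫ x, (v x (T x) - q (T x)) ∂μ

lemma IsDemand.continuousOn_profit (hr : IsRegularValue xl xh yl yh v d K) {q T : ℝ → ℝ}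
    (hT : IsDemand xl xh yl yh v q T) (hq : ConvexOn ℝ (Icc yl yh) q)
    (hqc : ContinuousOn q (Icc yl yh)) :
    ContinuousOn (fun x => v x (T x) - q (T x)) (Icc xl xh) := by
  have hTc := hT.continuousOn hr hq hqc
  refine ContinuousOn.sub ?_ (hqc.comp hTc fun x hx => (hT x hx).1)
  exact hr.lipschitz.continuousOn.comp (continuousOn_id.prodMk hTc)
    fun x hx => ⟨hx, (hT x hx).1⟩

variable {μ ν : Measure ℝ} [IsProbabilityMeasure μ] [IsProbabilityMeasure ν]

/-- A uniform change of wages by `ε` moves the wage bill and total profits by at most `ε` each;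
hence the dual value is continuous in the sup norm. -/
lemma dualValue_le_add (hr : IsRegularValue xl xh yl yh v d K) (hμ : ∀ᵐ x ∂μ, x ∈ Icc xl xh)
    (hν : ∀ᵐ z ∂ν, z ∈ Icc yl yh) {q₁ q₂ T₁ T₂ : ℝ → ℝ}
    (hT₁ : IsDemand xl xh yl yh v q₁ T₁) (hq₁ : ConvexOn ℝ (Icc yl yh) q₁)
    (hc₁ : ContinuousOn q₁ (Icc yl yh))
    (hT₂ : IsDemand xl xh yl yh v q₂ T₂) (hq₂ : ConvexOn ℝ (Icc yl yh) q₂)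
    (hc₂ : ContinuousOn q₂ (Icc yl yh)) {ε : ℝ} (h : ∀ z ∈ Icc yl yh, |q₁ z - q₂ z| ≤ ε) :
    dualValue μ ν v q₁ T₁ ≤ dualValue μ ν v q₂ T₂ + 2 * ε := by
  have h1 : ∫ z, q₁ z ∂ν ≤ ∫ z, (q₂ z + ε) ∂ν := by
    refine integral_mono_ae (integrable_of_continuousOn_Icc hν hc₁)
      ((integrable_of_continuousOn_Icc hν hc₂).add (integrable_const _)) ?_
    filter_upwards [hν] with z hz
    linarith [(abs_le.1 (h z hz)).2]
  have i2 := integrable_of_continuousOn_Icc hμ (hT₂.continuousOn_profit hr hq₂ hc₂)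
  have h2 : ∫ x, (v x (T₁ x) - q₁ (T₁ x)) ∂μ ≤ ∫ x, ((v x (T₂ x) - q₂ (T₂ x)) + ε) ∂μ := by
    refine integral_mono_ae
      (integrable_of_continuousOn_Icc hμ (hT₁.continuousOn_profit hr hq₁ hc₁))
      (i2.add (integrable_const _)) ?_
    filter_upwards [hμ] with x hx
    have h3 := (hT₂ x hx).2 _ (hT₁ x hx).1
    linarith [(abs_le.1 (h _ (hT₁ x hx).1)).1]
  rw [integral_add (integrable_of_continuousOn_Icc hν hc₂) (integrable_const _)] at h1
  rw [integral_add i2 (integrable_const _)] at h2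
  simp only [integral_const, probReal_univ, smul_eq_mul, one_mul] at h1 h2
  unfold dualValue
  linarith

/-- Infimal convolution with `K |·|`. -/
lemma exists_lipschitz_regularization (K : NNReal) (hy : yl < yh) {q : ℝ → ℝ}
    (hq : ConvexOn ℝ (Icc yl yh) q) (hqc : ContinuousOn q (Icc yl yh)) :
    ∃ (r w : ℝ → ℝ), ConvexOn ℝ (Icc yl yh) r ∧ LipschitzOnWith K r (Icc yl yh) ∧
      (∀ z ∈ Icc yl yh, r z ≤ q z) ∧
      ∀ z ∈ Icc yl yh, w z ∈ Icc yl yh ∧ r z = q (w z) + K * |z - w z| := by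
  have : ∀ z, ∃ w ∈ Icc yl yh, ∀ w' ∈ Icc yl yh, q w + K * |z - w| ≤ q w' + K * |z - w'| := by
    intro z
    obtain ⟨w, hw, hmin⟩ := isCompact_Icc.exists_isMinOn (nonempty_Icc.2 hy.le)
      (hqc.add (g := fun w => K * |z - w|) (by fun_prop))
    exact ⟨w, hw, fun w' hw' => hmin hw'⟩
  choose w hw hmin using this
  refine ⟨fun z => q (w z) + K * |z - w z|, w, ⟨convex_Icc _ _, ?_⟩, ?_, ?_,
    fun z _ => ⟨hw z, rfl⟩⟩
  · intro z₁ _ z₂ _ a b ha hb hab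
    refine (hmin _ _ ((convex_Icc yl yh) (hw z₁) (hw z₂) ha hb hab)).trans ?_
    have h1 := hq.2 (hw z₁) (hw z₂) ha hb hab
    simp only [smul_eq_mul] at h1 ⊢
    have h2 : |a * z₁ + b * z₂ - (a * w z₁ + b * w z₂)| ≤ a * |z₁ - w z₁| + b * |z₂ - w z₂| := by
      have e : a * z₁ + b * z₂ - (a * w z₁ + b * w z₂) = a * (z₁ - w z₁) + b * (z₂ - w z₂) := by
        ring
      rw [e]
      refine (abs_add_le _ _).trans ?_
      rw [abs_mul, abs_mul, abs_of_nonneg ha, abs_of_nonneg hb]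
    nlinarith [mul_le_mul_of_nonneg_left h2 K.coe_nonneg]
  · refine LipschitzOnWith.of_le_add_mul K fun z₁ _ z₂ _ => ?_
    refine (hmin z₁ _ (hw z₂)).trans ?_
    rw [Real.dist_eq, add_assoc, ← mul_add]
    have h2 := abs_sub_le z₁ z₂ (w z₂)
    have := mul_le_mul_of_nonneg_left h2 K.coe_nonneg
    linarith
  · intro z hz
    simpa using hmin z z hz

/-- Lowering `q` to its `K`-Lipschitz regularization `r` cuts the wage bill without raising profits.
Hiring `z` at `r z = q w + K |z - w|` is no better than hiring `w` at `q w`, as `v x` is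
`K`-Lipschitz. The later shift by `r yl` cancels because both laws have mass one. -/
lemma exists_lipschitz_dualValue_le (hr : IsRegularValue xl xh yl yh v d K) (hy : yl < yh)
    (hμ : ∀ᵐ x ∂μ, x ∈ Icc xl xh)
    (hν : ∀ᵐ z ∂ν, z ∈ Icc yl yh) {q T : ℝ → ℝ}
    (hT : IsDemand xl xh yl yh v q T) (hq : ConvexOn ℝ (Icc yl yh) q)
    (hqc : ContinuousOn q (Icc yl yh)) :
    ∃ r R : ℝ → ℝ, ConvexOn ℝ (Icc yl yh) r ∧ LipschitzOnWith K r (Icc yl yh) ∧ r yl = 0 ∧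
      IsDemand xl xh yl yh v r R ∧ dualValue μ ν v r R ≤ dualValue μ ν v q T := by
  obtain ⟨r, w, hr1, hr2, hr3, hr4⟩ := exists_lipschitz_regularization K hy hq hqc
  obtain ⟨R, hR⟩ := exists_isDemand hr hy hr2.continuousOn
  have ir := integrable_of_continuousOn_Icc hν hr2.continuousOn
  have iR := integrable_of_continuousOn_Icc hμ (hR.continuousOn_profit hr hr1 hr2.continuousOn)
  have h1 : ∫ z, r z ∂ν ≤ ∫ z, q z ∂ν := by
    refine integral_mono_ae ir (integrable_of_continuousOn_Icc hν hqc) ?_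
    filter_upwards [hν] with z hz using hr3 z hz
  have h2 : ∫ x, (v x (R x) - r (R x)) ∂μ ≤ ∫ x, (v x (T x) - q (T x)) ∂μ := by
    refine integral_mono_ae iR
      (integrable_of_continuousOn_Icc hμ (hT.continuousOn_profit hr hq hqc)) ?_
    filter_upwards [hμ] with x hx
    obtain ⟨h3, h4⟩ := hr4 (R x) (hR x hx).1
    have h5 := (hT x hx).2 _ h3
    have h6 := (abs_le.1 (hr.abs_sub_le_right hx (hR x hx).1 h3)).2
    linarith
  refine ⟨fun z => r z - r yl, R, ?_, ?_, sub_self _, fun x hx => ⟨(hR x hx).1, fun z hz => ?_⟩,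
    ?_⟩
  · simp only [sub_eq_add_neg]
    exact hr1.add_const (-r yl)
  · refine LipschitzOnWith.of_dist_le_mul fun a ha b hb => ?_
    simpa [Real.dist_eq] using hr2.dist_le_mul a ha b hb
  · linarith [(hR x hx).2 z hz]
  · unfold dualValue
    rw [integral_sub ir (integrable_const _)]
    have e : ∀ x, v x (R x) - (r (R x) - r yl) = (v x (R x) - r (R x)) + r yl := fun x => by ring
    simp only [e]
    rw [integral_add iR (integrable_const _)]
    simp only [integral_const, probReal_univ, smul_eq_mul, one_mul]
    linarith

/-- The dual problem has a solution. -/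
lemma exists_dualValue_le (hr : IsRegularValue xl xh yl yh v d K) (hy : yl < yh)
    (hμ : ∀ᵐ x ∂μ, x ∈ Icc xl xh) (hν : ∀ᵐ z ∂ν, z ∈ Icc yl yh) :
    ∃ q T : ℝ → ℝ, ConvexOn ℝ (Icc yl yh) q ∧ LipschitzOnWith K q (Icc yl yh) ∧
      IsDemand xl xh yl yh v q T ∧
      ∀ r R : ℝ → ℝ, IsDemand xl xh yl yh v r R → ConvexOn ℝ (Icc yl yh) r →
        ContinuousOn r (Icc yl yh) → dualValue μ ν v q T ≤ dualValue μ ν v r R := by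
  set E : BoundedContinuousFunction (Icc yl yh) ℝ → ℝ → ℝ :=
    fun b z => b (projIcc yl yh hy.le z) with hE
  have hEval : ∀ b z (hz : z ∈ Icc yl yh), E b z = b ⟨z, hz⟩ := fun b z hz => by
    simp only [hE, projIcc_of_mem hy.le hz]
  have hEc : ∀ b, Continuous (E b) := fun b => b.continuous.comp continuous_projIcc
  set A : Set (BoundedContinuousFunction (Icc yl yh) ℝ) :=
    {b | ConvexOn ℝ (Icc yl yh) (E b) ∧ LipschitzWith K b ∧ E b yl = 0}
  have hElim : ∀ {s : ℕ → BoundedContinuousFunction (Icc yl yh) ℝ} {b},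
      Filter.Tendsto s Filter.atTop (nhds b) →
      ∀ y, Filter.Tendsto (fun n => s n y) Filter.atTop (nhds (b y)) := fun hs y =>
    ((continuous_eval_const y).tendsto _).comp hs
  have hclosed : IsClosed A := by
    refine IsSeqClosed.isClosed fun s b hs hlim => ⟨⟨convex_Icc _ _, ?_⟩, ?_, ?_⟩
    · intro z₁ h₁ z₂ h₂ a c ha hc hac
      exact le_of_tendsto_of_tendsto' (hElim hlim _)
        (((hElim hlim _).const_mul a).add ((hElim hlim _).const_mul c))
        fun n => (hs n).1.2 h₁ h₂ ha hc hac
    · refine LipschitzWith.of_dist_le_mul fun y₁ y₂ => ?_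
      exact le_of_tendsto' ((hElim hlim y₁).dist (hElim hlim y₂))
        fun n => (hs n).2.1.dist_le_mul y₁ y₂
    · exact tendsto_nhds_unique (hElim hlim _)
        (tendsto_const_nhds.congr fun n => ((hs n).2.2).symm)
  have hLip : ∀ b ∈ A, LipschitzOnWith K (E b) (Icc yl yh) := by
    intro b hb
    refine LipschitzOnWith.of_dist_le_mul fun z₁ h₁ z₂ h₂ => ?_
    rw [hEval b z₁ h₁, hEval b z₂ h₂]
    exact hb.2.1.dist_le_mul _ _
  -- Arzelà–Ascoli: the normalization at `yl` and the Lipschitz bound confine all values to one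
  -- compact interval.
  have hcomp : IsCompact A := by
    refine BoundedContinuousFunction.arzela_ascoli₂ (Icc (-(K * (yh - yl))) (K * (yh - yl)))
      isCompact_Icc A hclosed (fun b y hb => ?_) ?_
    · have h1 := (hLip b hb).dist_le_mul y.1 y.2 yl (left_mem_Icc.2 hy.le)
      rw [hb.2.2, hEval b y.1 y.2, Real.dist_eq, Real.dist_eq, sub_zero,
        abs_of_nonneg (sub_nonneg.2 y.2.1)] at h1
      have h2 : (K : ℝ) * (y.1 - yl) ≤ K * (yh - yl) :=
        mul_le_mul_of_nonneg_left (by linarith [y.2.2]) K.coe_nonneg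
      exact abs_le.1 (h1.trans h2)
    · exact (LipschitzWith.uniformEquicontinuous _ K fun b => b.2.2.1).equicontinuous
  choose T hT using fun b => exists_isDemand hr hy (hEc b).continuousOn
  have hcont : ContinuousOn (fun b => dualValue μ ν v (E b) (T b)) A := by
    refine LipschitzOnWith.continuousOn (K := 2) ?_
    refine LipschitzOnWith.of_le_add_mul 2 fun b₁ h₁ b₂ h₂ => ?_
    refine dualValue_le_add hr hμ hν (hT b₁) h₁.1 (hEc b₁).continuousOn (hT b₂) h₂.1
      (hEc b₂).continuousOn fun z _ => ?_
    rw [← Real.dist_eq]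
    exact BoundedContinuousFunction.dist_coe_le_dist _
  have hmemA : ∀ r : ℝ → ℝ, ConvexOn ℝ (Icc yl yh) r → LipschitzOnWith K r (Icc yl yh) →
      r yl = 0 → ∃ b ∈ A, ∀ z ∈ Icc yl yh, E b z = r z := by
    intro r h1 h2 h3
    have hl : LipschitzWith K ((Icc yl yh).domRestrict r) := h2.to_restrict
    refine ⟨BoundedContinuousFunction.mkOfCompact ⟨(Icc yl yh).domRestrict r, hl.continuous⟩, ?_⟩
    have he : ∀ z ∈ Icc yl yh, E (BoundedContinuousFunction.mkOfCompact
        ⟨(Icc yl yh).domRestrict r, hl.continuous⟩) z = r z := fun z hz => by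
      rw [hEval _ z hz]; rfl
    exact ⟨⟨h1.congr fun z hz => (he z hz).symm, hl, by rw [he yl (left_mem_Icc.2 hy.le), h3]⟩, he⟩
  have hne : A.Nonempty := by
    obtain ⟨b, hb, -⟩ := hmemA (fun _ => 0) (convexOn_const 0 (convex_Icc _ _))
      (LipschitzWith.const' 0).lipschitzOnWith rfl
    exact ⟨b, hb⟩
  obtain ⟨b, hb, hmin⟩ := hcomp.exists_isMinOn hne hcont
  refine ⟨E b, T b, hb.1, hLip b hb, hT b, fun r R hR hr1 hr2 => ?_⟩
  obtain ⟨r', R', h1, h2, h3, h4, h5⟩ := exists_lipschitz_dualValue_le hr hy hμ hν hR hr1 hr2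
  obtain ⟨b', hb', he⟩ := hmemA r' h1 h2 h3
  refine le_trans (hmin hb') (le_trans ?_ h5)
  have := dualValue_le_add hr hμ hν (hT b') hb'.1 (hEc b').continuousOn h4 h1 h2.continuousOn
    (ε := 0) fun z hz => by simp [he z hz]
  simpa using this

/-- First-order condition for the dual problem. -/
lemma integral_comp_demand_le (hr : IsRegularValue xl xh yl yh v d K) (hy : yl < yh)
    (hμ : ∀ᵐ x ∂μ, x ∈ Icc xl xh) (hν : ∀ᵐ z ∂ν, z ∈ Icc yl yh) {q T : ℝ → ℝ}
    (hq : ConvexOn ℝ (Icc yl yh) q) (hqc : ContinuousOn q (Icc yl yh))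
    (hT : IsDemand xl xh yl yh v q T)
    (hmin : ∀ r R : ℝ → ℝ, IsDemand xl xh yl yh v r R → ConvexOn ℝ (Icc yl yh) r →
      ContinuousOn r (Icc yl yh) → dualValue μ ν v q T ≤ dualValue μ ν v r R)
    {r : ℝ → ℝ} (hrc : ContinuousOn r (Icc yl yh))
    (hqr : ∀ ε ∈ Ioo (0 : ℝ) 1, ConvexOn ℝ (Icc yl yh) fun z => q z + ε * r z) :
    ∫ x, r (T x) ∂μ ≤ ∫ z, r z ∂ν := by
  set e : ℕ → ℝ := fun n => 1 / ((n : ℝ) + 2) with he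
  have hepos : ∀ n, e n ∈ Ioo (0 : ℝ) 1 := fun n => by
    refine ⟨by positivity, ?_⟩
    rw [he, div_lt_one (by positivity)]
    linarith [Nat.cast_nonneg (α := ℝ) n]
  have helim : Filter.Tendsto e Filter.atTop (nhds 0) := by
    have h1 : Filter.Tendsto (fun n : ℕ => (n : ℝ) + 2) Filter.atTop Filter.atTop :=
      Filter.tendsto_atTop_add_const_right _ _ tendsto_natCast_atTop_atTop
    exact h1.const_div_atTop 1
  have hc : ∀ n, ContinuousOn (fun z => q z + e n * r z) (Icc yl yh) := fun n =>
    hqc.add (continuousOn_const.mul hrc)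
  choose Tn hTn using fun n => exists_isDemand hr hy (hc n)
  have hTnc : ∀ n, ContinuousOn (fun x => r (Tn n x)) (Icc xl xh) := fun n =>
    hrc.comp ((hTn n).continuousOn hr (hqr _ (hepos n)) (hc n)) fun x hx => (hTn n x hx).1
  have hle : ∀ n, ∫ x, r (Tn n x) ∂μ ≤ ∫ z, r z ∂ν := by
    intro n
    have h1 := hmin _ _ (hTn n) (hqr _ (hepos n)) (hc n)
    have iq := integrable_of_continuousOn_Icc hν hqc
    have ir := integrable_of_continuousOn_Icc hν hrc
    have iT := integrable_of_continuousOn_Icc hμ (hT.continuousOn_profit hr hq hqc)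
    have iTn := integrable_of_continuousOn_Icc hμ
      ((hTn n).continuousOn_profit hr (hqr _ (hepos n)) (hc n))
    have irT := integrable_of_continuousOn_Icc hμ (hTnc n)
    -- The perturbed demand is feasible at wages `q`, hence earns there at most what `T` earns.
    -- Combined with minimality of `q`, this leaves an inequality divisible by `e n`.
    have h2 : ∫ x, (v x (Tn n x) - (q (Tn n x) + e n * r (Tn n x))) ∂μ
        ≤ ∫ x, ((v x (T x) - q (T x)) - e n * r (Tn n x)) ∂μ := by
      refine integral_mono_ae iTn (iT.sub (irT.const_mul _)) ?_
      filter_upwards [hμ] with x hx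
      linarith [(hT x hx).2 _ (hTn n x hx).1]
    rw [integral_sub iT (irT.const_mul _), integral_const_mul] at h2
    unfold dualValue at h1
    rw [integral_add iq (ir.const_mul _), integral_const_mul] at h1
    have h3 : e n * ∫ x, r (Tn n x) ∂μ ≤ e n * ∫ z, r z ∂ν := by linarith
    exact le_of_mul_le_mul_left h3 (hepos n).1
  obtain ⟨M, hM⟩ := isCompact_Icc.exists_bound_of_continuousOn hrc
  refine le_of_tendsto' (tendsto_integral_of_dominated_convergence (fun _ => M)
    (fun n => (integrable_of_continuousOn_Icc hμ (hTnc n)).aestronglyMeasurable)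
    (integrable_const _) (fun n => ?_) ?_) hle
  · filter_upwards [hμ] with x hx using hM _ (hTn n x hx).1
  · filter_upwards [hμ] with x hx
    have h1 := hT.tendsto hr hq hqc hrc helim hTn hx
    refine ((hrc (T x) (hT x hx).1).tendsto).comp (tendsto_nhdsWithin_iff.2 ⟨h1, ?_⟩)
    exact Filter.Eventually.of_forall fun n => (hTn n x hx).1

end Dual

/-! ### Existence and uniqueness of the equilibrium assignment. -/

section Equilibrium

variable {xl xh yl yh : ℝ} {v d : ℝ → ℝ → ℝ} {K : NNReal} {μ ν : Measure ℝ}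

lemma ae_map_mem_Icc {α : Type*} [MeasurableSpace α] {ρ : Measure α} {T : α → ℝ}
    (hT : AEMeasurable T ρ) {a b : ℝ} (h : ∀ᵐ x ∂ρ, T x ∈ Icc a b) :
    ∀ᵐ z ∂ρ.map T, z ∈ Icc a b :=
  (ae_map_iff (p := fun z => z ∈ Icc a b) hT measurableSet_Icc).2 h

lemma exists_wages (hr : IsRegularValue xl xh yl yh v d K) (hx : xl < xh) (hy : yl < yh)
    [IsProbabilityMeasure μ] [IsProbabilityMeasure ν]
    (hμ : ∀ᵐ x ∂μ, x ∈ Icc xl xh) (hν : ∀ᵐ z ∂ν, z ∈ Icc yl yh) :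
    ∃ q T : ℝ → ℝ, ConvexOn ℝ (Icc yl yh) q ∧ LipschitzOnWith K q (Icc yl yh) ∧
      Continuous T ∧ IsDemand xl xh yl yh v q T ∧ ∫ x, q (T x) ∂μ = ∫ z, q z ∂ν ∧
      Majorizes yl yh (μ.map T) ν := by
  obtain ⟨q, T₀, hq, hqK, hT₀, hmin⟩ := exists_dualValue_le hr hy hμ hν
  have hqc := hqK.continuousOn
  have hfoc : ∀ {r : ℝ → ℝ}, ContinuousOn r (Icc yl yh) →
      (∀ ε ∈ Ioo (0 : ℝ) 1, ConvexOn ℝ (Icc yl yh) fun z => q z + ε * r z) →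
      ∫ x, r (T₀ x) ∂μ ≤ ∫ z, r z ∂ν := fun hrc hqr =>
    integral_comp_demand_le hr hy hμ hν hq hqc hT₀ hmin hrc hqr
  have hadd : ∀ {r : ℝ → ℝ}, ConvexOn ℝ (Icc yl yh) r →
      ∀ ε ∈ Ioo (0 : ℝ) 1, ConvexOn ℝ (Icc yl yh) fun z => q z + ε * r z := fun hrr ε hε =>
    hq.add (hrr.smul hε.1.le)
  -- Extending by projection makes the demand continuous on the whole line.
  set T : ℝ → ℝ := fun x => T₀ (projIcc xl xh hx.le x) with hTdef
  have hTeq : ∀ x ∈ Icc xl xh, T x = T₀ x := fun x hxX => by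
    simp only [hTdef, projIcc_of_mem hx.le hxX]
  have hTc : Continuous T :=
    (continuousOn_iff_continuous_domRestrict.1 (hT₀.continuousOn hr hq hqc)).comp
      continuous_projIcc
  have hT : IsDemand xl xh yl yh v q T := fun x hxX => by
    rw [hTeq x hxX]; exact hT₀ x hxX
  have hint : ∀ r : ℝ → ℝ, ∫ x, r (T x) ∂μ = ∫ x, r (T₀ x) ∂μ := fun r => by
    refine integral_congr_ae ?_
    filter_upwards [hμ] with x hxX
    rw [hTeq x hxX]
  have : IsProbabilityMeasure (μ.map T) := Measure.isProbabilityMeasure_map hTc.aemeasurable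
  have hηY : ∀ᵐ z ∂μ.map T, z ∈ Icc yl yh := by
    refine ae_map_mem_Icc hTc.aemeasurable ?_
    filter_upwards [hμ] with x hxX using (hT x hxX).1
  have hη : ∀ y, yl ≤ y → ∫ t in yl..y, distFun (μ.map T) t = ∫ x, (y - min (T₀ x) y) ∂μ := by
    intro y hy'
    rw [intervalIntegral_distFun _ (hηY.mono fun z hz => hz.1) hy',
      integral_map hTc.aemeasurable (by fun_prop), hint fun z => y - min z y]
  have hle : ∀ y, yl ≤ y → ∫ t in yl..y, distFun (μ.map T) t ≤ ∫ t in yl..y, distFun ν t := by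
    intro y hy'
    rw [hη y hy', intervalIntegral_distFun _ (hν.mono fun z hz => hz.1) hy']
    -- This convex function is `(y - z)⁺`, whose expectation is the integrated cdf.
    refine hfoc (r := fun z => y - min z y) (by fun_prop) (hadd ?_)
    exact (convexOn_const y (convex_Icc _ _)).sub
      ((concaveOn_id (convex_Icc _ _)).inf (concaveOn_const y (convex_Icc _ _)))
  refine ⟨q, T, hq, hqK, hTc, hT, ?_, fun y hy' => hle y hy'.1, le_antisymm (hle yh hy.le) ?_⟩
  · rw [hint q]
    refine le_antisymm (hfoc hqc (hadd hq)) ?_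
    -- Scaling wages down is admissible too: `q - ε q` remains convex because `ε < 1`.
    have h1 := hfoc (r := fun z => -q z) hqc.neg fun ε hε => by
      have e : (fun z => q z + ε * -q z) = fun z => (1 - ε) * q z := by
        funext z; ring
      rw [e]
      exact hq.smul (sub_nonneg.2 hε.2.le)
    rw [integral_neg, integral_neg] at h1
    linarith
  · rw [hη yh hy.le, intervalIntegral_distFun _ (hν.mono fun z hz => hz.1) hy.le]
    -- At `y = yh` the test function is affine on `[yl, yh]`, so its negative is also convex and the
    -- inequality becomes an equality.
    have h1 := hfoc (r := fun z => -(yh - min z yh)) (by fun_prop) (hadd ?_)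
    · rw [integral_neg, integral_neg] at h1
      linarith
    · have h2 : ConvexOn ℝ (Icc yl yh) (fun z => z + (-yh)) :=
        (convexOn_id (convex_Icc _ _)).add_const (-yh)
      refine h2.congr fun z hz => ?_
      simp only [min_eq_left hz.2]
      ring

/-- Profits serve as `p`. They are `K`-Lipschitz as a maximum of functions Lipschitz in `x`, and the
support lies in the graph of `T`, closed because `T` is continuous. -/
lemma isCompetitiveEquilibrium_map (hr : IsRegularValue xl xh yl yh v d K)
    [IsProbabilityMeasure μ] (hμ : ∀ᵐ x ∂μ, x ∈ Icc xl xh) {q T : ℝ → ℝ}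
    (hq : ConvexOn ℝ (Icc yl yh) q) (hqK : LipschitzOnWith K q (Icc yl yh)) (hTc : Continuous T)
    (hT : IsDemand xl xh yl yh v q T) (hqT : ∫ x, q (T x) ∂μ = ∫ z, q z ∂ν)
    (hmaj : Majorizes yl yh (μ.map T) ν) :
    IsCompetitiveEquilibrium xl xh yl yh μ ν v (μ.map fun x => (x, T x))
      (fun x => v x (T x) - q (T x)) q := by
  have hmeas : Measurable fun x => (x, T x) := by fun_prop
  have hfst : (μ.map fun x => (x, T x)).fst = μ := by
    rw [Measure.fst, Measure.map_map measurable_fst hmeas]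
    exact Measure.map_id
  have hsnd : (μ.map fun x => (x, T x)).snd = μ.map T := by
    rw [Measure.snd, Measure.map_map measurable_snd hmeas]
    rfl
  have hprob := Measure.isProbabilityMeasure_map (μ := μ) hmeas.aemeasurable
  refine ⟨⟨hprob, ?_, hfst, hsnd ▸ hmaj⟩, ⟨K, ?_⟩, ⟨K, hqK⟩, ?_, ?_, hq, ?_⟩
  · rw [Measure.map_apply hmeas (measurableSet_Icc.prod measurableSet_Icc).compl]
    refine measure_mono_null (t := (Icc xl xh)ᶜ) (fun x hx hxX => hx ⟨hxX, (hT x hxX).1⟩) hμ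
  · refine LipschitzOnWith.of_le_add_mul K fun x hx x' hx' => ?_
    rw [Real.dist_eq]
    have h1 := (abs_le.1 (hr.abs_sub_le_left hx hx' (hT x hx).1)).2
    linarith [(hT x' hx').2 _ (hT x hx).1]
  · have hcl : IsClosed {w : ℝ × ℝ | T w.1 = w.2} :=
      isClosed_eq (hTc.comp continuous_fst) continuous_snd
    have hsub : (μ.map fun x => (x, T x)).support ⊆ {w : ℝ × ℝ | T w.1 = w.2} := by
      refine Measure.support_subset_of_isClosed hcl ?_
      change ∀ᵐ w ∂(μ.map fun x => (x, T x)), T w.1 = w.2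
      rw [ae_map_iff hmeas.aemeasurable hcl.measurableSet]
      exact Filter.Eventually.of_forall fun x => rfl
    intro w hw
    have h1 : T w.1 = w.2 := hsub hw
    rw [← h1]
    ring
  · intro x hx z hz
    linarith [(hT x hx).2 z hz]
  · rw [hsnd]
    have hqη : AEStronglyMeasurable q (μ.map T) := by
      have hηY : ∀ᵐ z ∂μ.map T, z ∈ Icc yl yh := by
        refine ae_map_mem_Icc hTc.aemeasurable ?_
        filter_upwards [hμ] with x hxX using (hT x hxX).1
      have := Measure.isProbabilityMeasure_map (μ := μ) hTc.aemeasurable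
      exact (integrable_of_continuousOn_Icc hηY hqK.continuousOn).aestronglyMeasurable
    rw [integral_map hTc.aemeasurable hqη, hqT]

lemma IsAssignment.ae_mem {J : Measure (ℝ × ℝ)} (hJ : IsAssignment xl xh yl yh μ ν J) :
    ∀ᵐ w ∂J, w ∈ Icc xl xh ×ˢ Icc yl yh := hJ.concentrated

lemma IsAssignment.integrable {J : Measure (ℝ × ℝ)} (hJ : IsAssignment xl xh yl yh μ ν J)
    {φ : ℝ × ℝ → ℝ} (hφ : ContinuousOn φ (Icc xl xh ×ˢ Icc yl yh)) : Integrable φ J := by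
  have := hJ.isProbability
  rw [← Measure.restrict_eq_self_of_ae_mem hJ.ae_mem]
  exact hφ.integrableOn_compact (isCompact_Icc.prod isCompact_Icc)

lemma IsAssignment.integral_prices {J : Measure (ℝ × ℝ)}
    (hJ : IsAssignment xl xh yl yh μ ν J) {p q : ℝ → ℝ} (hp : ContinuousOn p (Icc xl xh))
    (hq : ContinuousOn q (Icc yl yh)) :
    ∫ w, (p w.1 + q w.2) ∂J = ∫ x, p x ∂μ + ∫ z, q z ∂J.snd := by
  have := hJ.isProbability
  have hp' : AEStronglyMeasurable p (J.map Prod.fst) := by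
    have h1 : ∀ᵐ x ∂J.map Prod.fst, x ∈ Icc xl xh := by
      refine ae_map_mem_Icc measurable_fst.aemeasurable ?_
      filter_upwards [hJ.ae_mem] with w hw using hw.1
    have := Measure.isProbabilityMeasure_map (μ := J) measurable_fst.aemeasurable
    exact (integrable_of_continuousOn_Icc h1 hp).aestronglyMeasurable
  have hq' : AEStronglyMeasurable q (J.map Prod.snd) := by
    have h1 : ∀ᵐ x ∂J.map Prod.snd, x ∈ Icc yl yh := by
      refine ae_map_mem_Icc measurable_snd.aemeasurable ?_
      filter_upwards [hJ.ae_mem] with w hw using hw.2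
    have := Measure.isProbabilityMeasure_map (μ := J) measurable_snd.aemeasurable
    exact (integrable_of_continuousOn_Icc h1 hq).aestronglyMeasurable
  have h1 : ∫ w, (p w.1 + q w.2) ∂J = ∫ w, p w.1 ∂J + ∫ w, q w.2 ∂J :=
    integral_add (hJ.integrable (hp.comp continuousOn_fst fun w hw => hw.1))
      (hJ.integrable (hq.comp continuousOn_snd fun w hw => hw.2))
  rw [h1, ← hJ.fst_eq, Measure.fst, Measure.snd, integral_map measurable_fst.aemeasurable hp',
    integral_map measurable_snd.aemeasurable hq']

lemma IsAssignment.integral_wage_le (hy : yl < yh) [IsProbabilityMeasure ν]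
    (hν : ∀ᵐ z ∂ν, z ∈ Icc yl yh) {J : Measure (ℝ × ℝ)}
    (hJ : IsAssignment xl xh yl yh μ ν J) {q : ℝ → ℝ} (hq : ConvexOn ℝ (Icc yl yh) q)
    (hqL : ∃ L, LipschitzOnWith L q (Icc yl yh)) : ∫ z, q z ∂J.snd ≤ ∫ z, q z ∂ν := by
  have := hJ.isProbability
  have hη : ∀ᵐ z ∂J.snd, z ∈ Icc yl yh := by
    refine ae_map_mem_Icc measurable_snd.aemeasurable ?_
    filter_upwards [hJ.ae_mem] with w hw using hw.2
  exact hJ.majorizes.integral_le hy hη hν hq hqL.choose_spec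

/-- Competitive equilibria maximize aggregate value. -/
lemma IsCompetitiveEquilibrium.integral_le (hr : IsRegularValue xl xh yl yh v d K)
    (hy : yl < yh) [IsProbabilityMeasure ν] (hν : ∀ᵐ z ∂ν, z ∈ Icc yl yh)
    {J J' : Measure (ℝ × ℝ)} {p q : ℝ → ℝ}
    (hE : IsCompetitiveEquilibrium xl xh yl yh μ ν v J p q)
    (hJ' : IsAssignment xl xh yl yh μ ν J') :
    ∫ w, v w.1 w.2 ∂J' ≤ ∫ w, v w.1 w.2 ∂J := by
  have hp := hE.lipschitz_p.choose_spec.continuousOn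
  have hq := hE.lipschitz_q.choose_spec.continuousOn
  have h1 : ∫ w, v w.1 w.2 ∂J' ≤ ∫ w, (p w.1 + q w.2) ∂J' := by
    refine integral_mono_ae (hJ'.integrable hr.lipschitz.continuousOn)
      (hJ'.integrable ((hp.comp continuousOn_fst fun w hw => hw.1).add
        (hq.comp continuousOn_snd fun w hw => hw.2))) ?_
    filter_upwards [hJ'.ae_mem] with w hw using hE.no_entry _ hw.1 _ hw.2
  have h2 : ∫ w, (p w.1 + q w.2) ∂J = ∫ w, v w.1 w.2 ∂J := by
    refine integral_congr_ae ?_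
    filter_upwards [Measure.support_mem_ae (μ := J)] with w hw using hE.eq_on_support w hw
  rw [hJ'.integral_prices hp hq] at h1
  rw [hE.assignment.integral_prices hp hq, hE.wage_bill] at h2
  linarith [hJ'.integral_wage_le hy hν hE.convex_q hE.lipschitz_q]

/-- The equilibrium assignment is unique. -/
lemma IsCompetitiveEquilibrium.eq_map (hr : IsRegularValue xl xh yl yh v d K)
    (hy : yl < yh) [IsProbabilityMeasure ν] (hν : ∀ᵐ z ∂ν, z ∈ Icc yl yh)
    {J' : Measure (ℝ × ℝ)} {q T p' q' : ℝ → ℝ} (hTc : Continuous T)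
    (hT : IsDemand xl xh yl yh v q T)
    (hE : IsCompetitiveEquilibrium xl xh yl yh μ ν v (μ.map fun x => (x, T x))
      (fun x => v x (T x) - q (T x)) q)
    (hE' : IsCompetitiveEquilibrium xl xh yl yh μ ν v J' p' q') :
    J' = μ.map fun x => (x, T x) := by
  have hJ' := hE'.assignment
  have hp := hE.lipschitz_p.choose_spec.continuousOn
  have hq := hE.lipschitz_q.choose_spec.continuousOn
  set p : ℝ → ℝ := fun x => v x (T x) - q (T x)
  have hval := le_antisymm (hE.integral_le hr hy hν hJ') (hE'.integral_le hr hy hν hE.assignment)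
  have ipq := hJ'.integrable ((hp.comp continuousOn_fst fun w hw => hw.1).add
        (hq.comp continuousOn_snd fun w hw => hw.2))
  have iv := hJ'.integrable hr.lipschitz.continuousOn
  have h2 : ∫ w, (p w.1 + q w.2) ∂(μ.map fun x => (x, T x))
      = ∫ w, v w.1 w.2 ∂(μ.map fun x => (x, T x)) := by
    refine integral_congr_ae ?_
    filter_upwards [Measure.support_mem_ae] with w hw using hE.eq_on_support w hw
  rw [hE.assignment.integral_prices hp hq, hE.wage_bill] at h2
  -- The surplus `p + q - v` is nonnegative and, since `J'` attains the same aggregate value, has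
  -- integral at most zero. It vanishes `J'`-almost everywhere, and uniqueness of demand puts `J'`
  -- on the graph of `T`.
  have hnn : 0 ≤ᵐ[J'] fun w => (p w.1 + q w.2) - v w.1 w.2 := by
    filter_upwards [hJ'.ae_mem] with w hw
    exact sub_nonneg.2 (hE.no_entry _ hw.1 _ hw.2)
  have h3 : ∫ w, ((p w.1 + q w.2) - v w.1 w.2) ∂J' ≤ 0 := by
    have h4 : ∫ w, ((p w.1 + q w.2) - v w.1 w.2) ∂J'
        = ∫ w, (p w.1 + q w.2) ∂J' - ∫ w, v w.1 w.2 ∂J' := integral_sub ipq iv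
    rw [h4, hJ'.integral_prices hp hq]
    linarith [hJ'.integral_wage_le hy hν hE.convex_q hE.lipschitz_q]
  have h5 := (integral_eq_zero_iff_of_nonneg_ae hnn (ipq.sub iv)).1
    (le_antisymm h3 (integral_nonneg_of_ae hnn))
  have h6 : ∀ᵐ w ∂J', w = (w.1, T w.1) := by
    filter_upwards [h5, hJ'.ae_mem] with w hw hwm
    refine Prod.ext rfl (hT.eq hr hE.convex_q hwm.1 hwm.2 ?_)
    simp only [Pi.zero_apply] at hw
    have : p w.1 = v w.1 (T w.1) - q (T w.1) := rfl
    linarith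
  calc J' = J'.map id := Measure.map_id.symm
    _ = J'.map fun w => (w.1, T w.1) := Measure.map_congr h6
    _ = (J'.map Prod.fst).map fun x => (x, T x) := by
        rw [Measure.map_map (by fun_prop) measurable_fst]
        rfl
    _ = μ.map fun x => (x, T x) := by
        rw [← hJ'.fst_eq]; rfl

end Equilibrium

/-! ### First-order conditions along the matching. -/

section Compression

variable {xl xh yl yh : ℝ} {f : ℝ → ℝ} {v d : ℝ → ℝ → ℝ} {K : NNReal} {S T : ℝ → ℝ}

/-- Move from `T x` a fraction `ε` towards `z`. Optimality and concavity of `v x` bound the wage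
change below by `ε v_z (z - T x)`, with `v_z` at the moved point; convexity of `q` bounds it above
by `ε (q z - q (T x))`. Divide by `ε` and let `ε → 0`. -/
lemma IsDemand.subgradient (hr : IsRegularValue xl xh yl yh v d K) {q : ℝ → ℝ}
    (hT : IsDemand xl xh yl yh v q T) (hq : ConvexOn ℝ (Icc yl yh) q) {x z : ℝ}
    (hx : x ∈ Icc xl xh) (hz : z ∈ Icc yl yh) :
    d x (T x) * (z - T x) ≤ q z - q (T x) := by
  obtain ⟨hTY, hmax⟩ := hT x hx
  set s : ℝ → ℝ := fun ε => T x + ε * (z - T x) with hs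
  have hsY : ∀ ε ∈ Icc (0 : ℝ) 1, s ε ∈ Icc yl yh := fun ε hε => by
    have := (convex_Icc yl yh).add_smul_sub_mem hTY hz hε
    simpa [hs] using this
  have hcont : ContinuousOn (fun ε => d x (s ε) * (z - T x)) (Icc 0 1) := by
    refine ContinuousOn.mul ?_ continuousOn_const
    refine hr.continuousOn_deriv.comp (f := fun ε => (x, s ε)) (by fun_prop)
      fun ε hε => ⟨hx, hsY ε hε⟩
  have hlim : Filter.Tendsto (fun ε => d x (s ε) * (z - T x)) (nhdsWithin 0 (Ioc 0 1))
      (nhds (d x (T x) * (z - T x))) := by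
    have h0 := (hcont 0 (left_mem_Icc.2 zero_le_one)).tendsto
    simp only [hs, zero_mul, add_zero] at h0
    exact h0.mono_left (nhdsWithin_mono _ Ioc_subset_Icc_self)
  have : (nhdsWithin (0 : ℝ) (Ioc 0 1)).NeBot := by
    rw [nhdsWithin_Ioc_eq_nhdsGT one_pos]; infer_instance
  refine le_of_tendsto hlim ?_
  filter_upwards [self_mem_nhdsWithin] with ε hε
  have hsε := hsY ε (Ioc_subset_Icc_self hε)
  have h1 : v x (T x) ≤ v x (s ε) + d x (s ε) * (T x - s ε) := by
    rcases eq_or_ne (T x) (s ε) with h | h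
    · rw [← h]; simp
    · exact (hr.lt_tangent hx hsε hTY h).le
  have h2 := hmax _ hsε
  have h3 := hq.2 hTY hz (sub_nonneg.2 hε.2) hε.1.le (by ring)
  simp only [smul_eq_mul] at h3
  rw [show (1 - ε) * T x + ε * z = s ε by simp only [hs]; ring] at h3
  have h4 : ε * (d x (s ε) * (z - T x)) ≤ ε * (q z - q (T x)) := by
    have : d x (s ε) * (T x - s ε) = -(ε * (d x (s ε) * (z - T x))) := by
      simp only [hs]; ring
    linarith
  exact le_of_mul_le_mul_left h4 hε.1

/-- Where `T` strictly increases this is monotonicity of subgradients of `q`; where `T` is constant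
it is `v_xz > 0`. -/
lemma IsDemand.monotoneOn_deriv (hr : IsRegularValue xl xh yl yh v d K) {q : ℝ → ℝ}
    (hT : IsDemand xl xh yl yh v q T) (hq : ConvexOn ℝ (Icc yl yh) q) :
    MonotoneOn (fun x => d x (T x)) (Icc xl xh) := by
  intro x₁ h₁ x₂ h₂ h12
  rcases eq_or_lt_of_le (hT.monotoneOn hr h₁ h₂ h12) with h | h
  · simp only [h]
    exact (hr.strictMono _ (hT x₂ h₂).1).monotoneOn h₁ h₂ h12
  · have h3 := hT.subgradient hr hq h₁ (hT x₂ h₂).1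
    have h4 := hT.subgradient hr hq h₂ (hT x₁ h₁).1
    have h5 : (d x₁ (T x₁) - d x₂ (T x₂)) * (T x₂ - T x₁) ≤ 0 := by nlinarith
    simp only
    nlinarith

/-- Cumulative difference of the matchings `T` and `S`. -/
noncomputable def cumulGap (xl xh : ℝ) (f S T : ℝ → ℝ) (x : ℝ) : ℝ :=
  ∫ t in Icc xl x, (T t - S t) ∂densityLaw xl xh f

lemma cumulGap_left : cumulGap xl xh f S T xl = 0 := by
  simp [cumulGap]

/-- First-order conditions of the planner's problem of choosing a matching `T` whose cumulative
gap over `S` is nonnegative: `v_z` along `T` is increasing, and constant where the gap is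
positive. -/
structure IsOptimalMatching (xl xh yl yh : ℝ) (f : ℝ → ℝ) (d : ℝ → ℝ → ℝ) (S T : ℝ → ℝ) :
    Prop where
  continuous_left : Continuous S
  continuous_right : Continuous T
  mem_left : ∀ x ∈ Icc xl xh, S x ∈ Icc yl yh
  mem_right : ∀ x ∈ Icc xl xh, T x ∈ Icc yl yh
  gap_nonneg : ∀ x ∈ Icc xl xh, 0 ≤ cumulGap xl xh f S T x
  gap_top : cumulGap xl xh f S T xh = 0
  monotone : MonotoneOn (fun x => d x (T x)) (Icc xl xh)
  integral_nonneg : 0 ≤ ∫ x, d x (T x) * (T x - S x) ∂densityLaw xl xh f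

lemma setIntegral_Iic_densityLaw (φ : ℝ → ℝ) (c : ℝ) :
    ∫ t in Iic c, φ t ∂densityLaw xl xh f = ∫ t in Icc xl c, φ t ∂densityLaw xl xh f := by
  refine setIntegral_congr_set ?_
  filter_upwards [ae_mem_densityLaw (a := xl) (b := xh) (f := f)] with t ht
  exact propext ⟨fun h => ⟨ht.1, h⟩, fun h => h.2⟩

variable [IsProbabilityMeasure (densityLaw xl xh f)]

lemma isOptimalMatching (hr : IsRegularValue xl xh yl yh v d K)
    (hy : yl < yh) {q : ℝ → ℝ} (hq : ConvexOn ℝ (Icc yl yh) q)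
    (hqc : ContinuousOn q (Icc yl yh)) (hTc : Continuous T) (hT : IsDemand xl xh yl yh v q T)
    (hSc : Continuous S) (hSY : ∀ x ∈ Icc xl xh, S x ∈ Icc yl yh)
    (hSm : StrictMonoOn S (Icc xl xh))
    (hqT : ∫ x, q (T x) ∂densityLaw xl xh f = ∫ x, q (S x) ∂densityLaw xl xh f)
    (hmaj : Majorizes yl yh ((densityLaw xl xh f).map T) ((densityLaw xl xh f).map S)) :
    IsOptimalMatching xl xh yl yh f d S T := by
  set μ := densityLaw xl xh f
  have hae := ae_mem_densityLaw (a := xl) (b := xh) (f := f)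
  have hTY : ∀ x ∈ Icc xl xh, T x ∈ Icc yl yh := fun x hx => (hT x hx).1
  have hmono := hT.monotoneOn_deriv hr hq
  have hint : ∀ {φ : ℝ → ℝ}, ContinuousOn φ (Icc xl xh) → Integrable φ μ := fun hφ =>
    integrable_of_continuousOn_Icc hae hφ
  have hdist : ∀ R : ℝ → ℝ, Continuous R → (∀ x ∈ Icc xl xh, R x ∈ Icc yl yh) → ∀ y, yl ≤ y →
      ∫ t in yl..y, distFun (μ.map R) t = ∫ x, (y - min (R x) y) ∂μ := by
    intro R hR hRY y hy'
    have := Measure.isProbabilityMeasure_map (μ := μ) hR.aemeasurable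
    have h1 : ∀ᵐ z ∂μ.map R, z ∈ Icc yl yh := by
      refine ae_map_mem_Icc hR.aemeasurable ?_
      filter_upwards [hae] with x hx using hRY x hx
    rw [intervalIntegral_distFun _ (h1.mono fun z hz => hz.1) hy',
      integral_map hR.aemeasurable (by fun_prop)]
  have hle : ∀ y ∈ Icc yl yh, ∫ x, (y - min (T x) y) ∂μ ≤ ∫ x, (y - min (S x) y) ∂μ := by
    intro y hy'
    rw [← hdist T hTc hTY y hy'.1, ← hdist S hSc hSY y hy'.1]
    exact hmaj.1 y hy'
  have htop : ∫ x, (T x - S x) ∂μ = 0 := by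
    have h1 := hmaj.2
    rw [hdist T hTc hTY yh hy.le, hdist S hSc hSY yh hy.le] at h1
    have h2 : ∀ R : ℝ → ℝ, Continuous R → (∀ x ∈ Icc xl xh, R x ∈ Icc yl yh) →
        ∫ x, (yh - min (R x) yh) ∂μ = yh - ∫ x, R x ∂μ := by
      intro R hR hRY
      have h3 : ∫ x, (yh - min (R x) yh) ∂μ = ∫ x, (yh - R x) ∂μ := by
        refine integral_congr_ae ?_
        filter_upwards [hae] with x hx
        rw [min_eq_left (hRY x hx).2]
      rw [h3, integral_sub (integrable_const _) (hint hR.continuousOn)]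
      simp
    rw [h2 T hTc hTY, h2 S hSc hSY] at h1
    rw [integral_sub (hint hTc.continuousOn) (hint hSc.continuousOn)]
    linarith
  refine ⟨hSc, hTc, hSY, hTY, fun x₀ hx₀ => ?_, ?_, hmono, ?_⟩
  -- Test majorization at the level `S x₀`. For `S` the positive part lives exactly on `x ≤ x₀`; for
  -- `T` restricting to `x ≤ x₀` and dropping the positive part only lowers the integral.
  · have h1 := hle (S x₀) (hSY x₀ hx₀)
    have h2 : ∫ x, (S x₀ - min (S x) (S x₀)) ∂μ = ∫ x in Iic x₀, (S x₀ - S x) ∂μ := by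
      rw [← integral_indicator measurableSet_Iic]
      refine integral_congr_ae ?_
      filter_upwards [hae] with x hx
      by_cases h : x ≤ x₀
      · rw [indicator_of_mem (mem_Iic.2 h), min_eq_left (hSm.monotoneOn hx hx₀ h)]
      · rw [indicator_of_notMem (by simpa using h),
          min_eq_right (hSm.monotoneOn hx₀ hx (not_le.1 h).le), sub_self]
    have h3 : ∫ x in Iic x₀, (S x₀ - T x) ∂μ ≤ ∫ x, (S x₀ - min (T x) (S x₀)) ∂μ := by
      rw [← integral_indicator measurableSet_Iic]
      refine integral_mono
        ((hint (φ := fun x => S x₀ - T x) (by fun_prop)).indicator measurableSet_Iic)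
        (hint (by fun_prop)) fun x => ?_
      by_cases h : x ≤ x₀
      · rw [indicator_of_mem (mem_Iic.2 h)]
        linarith [min_le_left (T x) (S x₀)]
      · rw [indicator_of_notMem (by simpa using h)]
        exact sub_nonneg.2 (min_le_right (T x) (S x₀))
    have h4 : ∫ x in Iic x₀, (T x - S x) ∂μ
        = ∫ x in Iic x₀, (S x₀ - S x) ∂μ - ∫ x in Iic x₀, (S x₀ - T x) ∂μ := by
      rw [← integral_sub (hint (by fun_prop)).integrableOn (hint (by fun_prop)).integrableOn]
      congr 1
      funext x
      ring
    rw [cumulGap, ← setIntegral_Iic_densityLaw, h4]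
    linarith
  · rw [cumulGap, densityLaw_restrict_Icc, htop]
  · have hdT : ContinuousOn (fun x => d x (T x)) (Icc xl xh) :=
      hr.continuousOn_deriv.comp (f := fun x => (x, T x)) (by fun_prop) fun x hx => ⟨hx, hTY x hx⟩
    have iS := hint (hqc.comp hSc.continuousOn hSY)
    have iT := hint (hqc.comp hTc.continuousOn hTY)
    have h1 : ∫ x, (q (T x) - q (S x)) ∂μ ≤ ∫ x, d x (T x) * (T x - S x) ∂μ := by
      refine integral_mono_ae (iT.sub iS)
        (hint (hdT.mul (hTc.sub hSc).continuousOn)) ?_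
      filter_upwards [hae] with x hx
      nlinarith [hT.subgradient hr hq hx (hSY x hx)]
    have h2 : ∫ x, (q (T x) - q (S x)) ∂μ = ∫ x, q (T x) ∂μ - ∫ x, q (S x) ∂μ :=
      integral_sub iT iS
    linarith

namespace IsOptimalMatching

lemma integrable (hO : IsOptimalMatching xl xh yl yh f d S T)
    :
    Integrable (fun t => T t - S t) (densityLaw xl xh f) :=
  integrable_densityLaw (hO.continuous_right.sub hO.continuous_left).continuousOn

lemma gap_eq (hO : IsOptimalMatching xl xh yl yh f d S T)
    {a b : ℝ} (ha : xl ≤ a) (hab : a ≤ b) :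
    cumulGap xl xh f S T b
      = cumulGap xl xh f S T a + ∫ t in Ioc a b, (T t - S t) ∂densityLaw xl xh f := by
  rw [cumulGap, cumulGap, ← Icc_union_Ioc_eq_Icc ha hab,
    setIntegral_union ((disjoint_left).2 fun t h1 h2 => absurd h1.2 (not_le.2 h2.1))
      measurableSet_Ioc hO.integrable.integrableOn hO.integrable.integrableOn]

lemma continuousOn_gap (hO : IsOptimalMatching xl xh yl yh f d S T)
    : ContinuousOn (cumulGap xl xh f S T) (Icc xl xh) := by
  have := intervalIntegral.continuousOn_primitive (a := xl) (b := xh)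
    (hO.integrable.integrableOn (s := Icc xl xh))
  refine this.congr fun x _ => ?_
  rw [cumulGap, integral_Icc_eq_integral_Ioc]

lemma gap_lt (hO : IsOptimalMatching xl xh yl yh f d S T)
    (hf : IsPosContDensity xl xh f) {a b : ℝ} (ha : xl ≤ a) (hab : a < b) (hb : b ≤ xh)
    (h : ∀ t ∈ Ioo a b, S t < T t) : cumulGap xl xh f S T a < cumulGap xl xh f S T b := by
  rw [hO.gap_eq ha hab.le]
  have := hf.setIntegral_pos (hO.continuous_right.sub hO.continuous_left).continuousOn ha hab hb
    fun t ht => sub_pos.2 (h t ht)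
  simp only [Pi.sub_apply] at this
  linarith

lemma lt_gap (hO : IsOptimalMatching xl xh yl yh f d S T)
    (hf : IsPosContDensity xl xh f) {a b : ℝ} (ha : xl ≤ a) (hab : a < b) (hb : b ≤ xh)
    (h : ∀ t ∈ Ioo a b, T t < S t) : cumulGap xl xh f S T b < cumulGap xl xh f S T a := by
  rw [hO.gap_eq ha hab.le]
  have := hf.setIntegral_pos (hO.continuous_left.sub hO.continuous_right).continuousOn ha hab hb
    fun t ht => sub_pos.2 (h t ht)
  have h2 : ∫ t in Ioc a b, (S - T) t ∂densityLaw xl xh f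
      = -∫ t in Ioc a b, (T t - S t) ∂densityLaw xl xh f := by
    rw [← integral_neg]
    congr 1
    funext t
    simp
  linarith

/-- The gap is nonnegative, so it is minimal at `x`: `T < S` near `x` would make it negative just to
the right, `T > S` just to the left. -/
lemma eq_of_gap_eq_zero (hO : IsOptimalMatching xl xh yl yh f d S T)
    (hf : IsPosContDensity xl xh f) {x : ℝ} (hx : x ∈ Ioo xl xh)
    (h : cumulGap xl xh f S T x = 0) : T x = S x := by
  rcases lt_trichotomy (T x) (S x) with hlt | he | hgt
  · have h1 : ∀ᶠ t in nhds x, T t < S t :=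
      hO.continuous_right.continuousAt.eventually_lt hO.continuous_left.continuousAt hlt
    obtain ⟨u, hu, hsub⟩ := exists_Ico_subset_of_mem_nhds h1 ⟨xh, hx.2⟩
    have h2 : x < min u xh := lt_min hu hx.2
    have := hO.lt_gap hf hx.1.le h2 (min_le_right _ _) fun t ht =>
      hsub ⟨ht.1.le, ht.2.trans_le (min_le_left _ _)⟩
    linarith [hO.gap_nonneg (min u xh) ⟨(hx.1.trans h2).le, min_le_right _ _⟩]
  · exact he
  · have h1 : ∀ᶠ t in nhds x, S t < T t :=
      hO.continuous_left.continuousAt.eventually_lt hO.continuous_right.continuousAt hgt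
    obtain ⟨u, hu, hsub⟩ := exists_Ioc_subset_of_mem_nhds h1 ⟨xl, hx.1⟩
    have h2 : max u xl < x := max_lt hu hx.1
    have := hO.gap_lt hf (le_max_right _ _) h2 hx.2.le fun t ht =>
      hsub ⟨(le_max_left _ _).trans_lt ht.1, ht.2.le⟩
    linarith [hO.gap_nonneg (max u xl) ⟨le_max_right _ _, (h2.trans hx.2).le⟩]

lemma integral_mul_le (hO : IsOptimalMatching xl xh yl yh f d S T)
    (hx : xl < xh) {k : ℝ → ℝ} (hk : MonotoneOn k (Icc xl xh))
    {a b σ : ℝ} (ha : a ∈ Icc xl xh) (hb : b ∈ Icc xl xh) (hab : a ≤ b)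
    (hσ : ∀ c ∈ Icc a b, σ ≤ cumulGap xl xh f S T c) :
    ∫ t, k t * (T t - S t) ∂densityLaw xl xh f ≤ -σ * (k b - k a) := by
  set k' : ℝ → ℝ := fun t => k (projIcc xl xh hx.le t) with hk'
  have hkeq : ∀ t ∈ Icc xl xh, k' t = k t := fun t ht => by
    simp only [hk', projIcc_of_mem hx.le ht]
  have hmono : Monotone k' := fun s t hst =>
    hk (projIcc xl xh hx.le s).2 (projIcc xl xh hx.le t).2 (monotone_projIcc hx.le hst)
  have hbd : ∀ t, k' t ∈ Icc (k xl) (k xh) := fun t =>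
    ⟨hk (left_mem_Icc.2 hx.le) (projIcc xl xh hx.le t).2 (projIcc xl xh hx.le t).2.1,
      hk (projIcc xl xh hx.le t).2 (right_mem_Icc.2 hx.le) (projIcc xl xh hx.le t).2.2⟩
  have h0 : ∫ t, (T t - S t) ∂densityLaw xl xh f = 0 := by
    rw [← hO.gap_top, cumulGap, densityLaw_restrict_Icc]
  have hnn : ∀ c, 0 ≤ ∫ t in Iic c, (T t - S t) ∂densityLaw xl xh f := by
    intro c
    rcases lt_or_ge c xl with h1 | h1
    · rw [setIntegral_Iic_densityLaw, Icc_eq_empty (not_le.2 h1), setIntegral_empty]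
    rcases le_total c xh with h2 | h2
    · rw [setIntegral_Iic_densityLaw]
      exact hO.gap_nonneg c ⟨h1, h2⟩
    · rw [Measure.restrict_eq_self_of_ae_mem, h0]
      filter_upwards [ae_mem_densityLaw (a := xl) (b := xh) (f := f)] with t ht
      exact ht.2.trans h2
  have := integral_monotone_mul_le hmono hbd hO.integrable h0 hnn hab (σ := σ) fun c hc => by
    rw [setIntegral_Iic_densityLaw]
    exact hσ c hc
  rw [hkeq a ha, hkeq b hb] at this
  refine le_trans (le_of_eq ?_) this
  refine integral_congr_ae ?_
  filter_upwards [ae_mem_densityLaw (a := xl) (b := xh) (f := f)] with t ht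
  rw [hkeq t ht]

/-- `v_z` is constant along the matching where the cumulative gap is positive. -/
lemma deriv_eq (hO : IsOptimalMatching xl xh yl yh f d S T)
    (hx : xl < xh) {a b : ℝ} (ha : a ∈ Icc xl xh) (hb : b ∈ Icc xl xh) (hab : a ≤ b)
    (h : ∀ c ∈ Icc a b, 0 < cumulGap xl xh f S T c) : d a (T a) = d b (T b) := by
  refine le_antisymm (hO.monotone ha hb hab) ?_
  have hsub : Icc a b ⊆ Icc xl xh := Icc_subset_Icc ha.1 hb.2
  obtain ⟨c, hc, hmin⟩ := isCompact_Icc.exists_isMinOn (nonempty_Icc.2 hab)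
    (hO.continuousOn_gap.mono hsub)
  -- With `σ > 0` the minimum of the gap on `[a, b]`, an increase of `v_z` between `a` and `b` would
  -- make the integral negative.
  have h1 := hO.integral_mul_le hx hO.monotone ha hb hab fun t ht => hmin ht
  have h2 := h c hc
  have h3 := hO.integral_nonneg
  by_contra! h4
  nlinarith [mul_pos h2 (sub_pos.2 h4)]

end IsOptimalMatching

end Compression

/-! ### From the shape of `v_z` along `S` to the shape of the compression set. -/

section Shape

variable {xl xh yl yh : ℝ} {f : ℝ → ℝ} {v d : ℝ → ℝ → ℝ} {K : NNReal} {S T : ℝ → ℝ}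

/-- Since `m c` is not below `m b`, the triple `t < b < c` forces `m t < m b`; then the triple `t <
u < b` forces `m t < m u`. -/
lemma StrictQuasiconcave.strictMonoOn {a b c : ℝ} {m : ℝ → ℝ} {s : Set ℝ} (hs : s.OrdConnected)
    (hm : StrictQuasiconcave s m) (ha : a ∈ s) (hc : c ∈ s) (hbc : b < c) (h : m b ≤ m c) :
    StrictMonoOn m (Icc a b) := by
  have hmem : ∀ t ∈ Icc a b, t ∈ s := fun t ht => hs.out ha hc ⟨ht.1, ht.2.trans hbc.le⟩
  have hlt : ∀ t ∈ Icc a b, t < b → m t < m b := fun t ht htb => by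
    have h1 := hm t (hmem t ht) b (hmem b ⟨ht.1.trans ht.2, le_rfl⟩) c hc htb hbc
    rcases min_lt_iff.1 h1 with h2 | h2
    · exact h2
    · exact absurd h (not_le.2 h2)
  intro t ht u hu htu
  rcases eq_or_lt_of_le hu.2 with rfl | hub
  · exact hlt t ht htu
  · have h1 := hm t (hmem t ht) u (hmem u hu) b (hmem b ⟨ht.1.trans ht.2, le_rfl⟩) htu hub
    rcases min_lt_iff.1 h1 with h2 | h2
    · exact h2
    · exact absurd (hlt u hu hub) (not_lt.2 h2.le)

lemma StrictQuasiconvex.strictMonoOn {a b c : ℝ} {m : ℝ → ℝ} {s : Set ℝ} (hs : s.OrdConnected)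
    (hm : StrictQuasiconvex s m) (hc : c ∈ s) (hb : b ∈ s) (hca : c < a) (h : m c ≤ m a) :
    StrictMonoOn m (Icc a b) := by
  have hmem : ∀ t ∈ Icc a b, t ∈ s := fun t ht => hs.out hc hb ⟨hca.le.trans ht.1, ht.2⟩
  have hlt : ∀ t ∈ Icc a b, a < t → m a < m t := fun t ht htb => by
    have h1 := hm c hc a (hmem a ⟨le_rfl, ht.1.trans ht.2⟩) t (hmem t ht) hca htb
    rcases lt_max_iff.1 h1 with h2 | h2
    · exact absurd h (not_le.2 h2)
    · exact h2
  intro t ht u hu htu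
  rcases eq_or_lt_of_le ht.1 with rfl | hat
  · exact hlt u hu htu
  · have h1 := hm a (hmem a ⟨le_rfl, ht.1.trans ht.2⟩) t (hmem t ht) u (hmem u hu) hat htu
    rcases lt_max_iff.1 h1 with h2 | h2
    · exact absurd (hlt t ht hat) (not_lt.2 h2.le)
    · exact h2

/-- A continuous nonnegative function vanishing at the ends of an interval and positive at an
interior point is positive on a maximal open subinterval around that point. -/
lemma exists_excursion {φ : ℝ → ℝ} {a b c : ℝ} (hφ : ContinuousOn φ (Icc a b))
    (hnn : ∀ t ∈ Icc a b, 0 ≤ φ t) (ha : φ a = 0) (hb : φ b = 0) (hc : c ∈ Icc a b)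
    (hpos : 0 < φ c) :
    ∃ s ∈ Ico a c, ∃ t ∈ Ioc c b, φ s = 0 ∧ φ t = 0 ∧ ∀ u ∈ Ioo s t, 0 < φ u := by
  have hcl : IsClosed (Icc a b ∩ φ ⁻¹' {0}) :=
    hφ.preimage_isClosed_of_isClosed isClosed_Icc isClosed_singleton
  have hab : a ≤ b := hc.1.trans hc.2
  have hL : IsCompact (Icc a c ∩ (Icc a b ∩ φ ⁻¹' {0})) := isCompact_Icc.inter_right hcl
  have hR : IsCompact (Icc c b ∩ (Icc a b ∩ φ ⁻¹' {0})) := isCompact_Icc.inter_right hcl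
  obtain ⟨s, ⟨hs1, hs2, hs3⟩, hsmax⟩ := hL.exists_isGreatest
    ⟨a, ⟨le_rfl, hc.1⟩, ⟨le_rfl, hab⟩, ha⟩
  obtain ⟨t, ⟨ht1, ht2, ht3⟩, htmin⟩ := hR.exists_isLeast
    ⟨b, ⟨hc.2, le_rfl⟩, ⟨hab, le_rfl⟩, hb⟩
  have hs0 : φ s = 0 := hs3
  have ht0 : φ t = 0 := ht3
  have hsc : s ≠ c := fun h => by rw [h] at hs0; exact hpos.ne' hs0
  have htc : t ≠ c := fun h => by rw [h] at ht0; exact hpos.ne' ht0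
  refine ⟨s, ⟨hs1.1, lt_of_le_of_ne hs1.2 hsc⟩, t, ⟨lt_of_le_of_ne ht1.1 htc.symm, ht1.2⟩,
    hs0, ht0, fun u hu => ?_⟩
  have huI : u ∈ Icc a b := ⟨hs1.1.trans hu.1.le, hu.2.le.trans ht1.2⟩
  refine lt_of_le_of_ne (hnn u huI) fun h => ?_
  rcases le_total u c with huc | huc
  · exact absurd (hsmax ⟨⟨huI.1, huc⟩, huI, h.symm⟩) (not_le.2 hu.1)
  · exact absurd (htmin ⟨⟨huc, huI.2⟩, huI, h.symm⟩) (not_le.2 hu.2)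

namespace IsOptimalMatching

lemma continuousOn_deriv (hr : IsRegularValue xl xh yl yh v d K)
    (hO : IsOptimalMatching xl xh yl yh f d S T) :
    ContinuousOn (fun x => d x (T x)) (Icc xl xh) := by
  have := hO.continuous_right
  exact hr.continuousOn_deriv.comp (f := fun x => (x, T x)) (by fun_prop)
    fun x hx => ⟨hx, hO.mem_right x hx⟩

lemma right_lt_left (hr : IsRegularValue xl xh yl yh v d K)
    (hO : IsOptimalMatching xl xh yl yh f d S T) {x : ℝ} (hx : x ∈ Icc xl xh)
    (h : d x (S x) < d x (T x)) : T x < S x :=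
  ((hr.strictAnti x hx).lt_iff_gt (hO.mem_left x hx) (hO.mem_right x hx)).1 h

lemma left_lt_right (hr : IsRegularValue xl xh yl yh v d K)
    (hO : IsOptimalMatching xl xh yl yh f d S T) {x : ℝ} (hx : x ∈ Icc xl xh)
    (h : d x (T x) < d x (S x)) : S x < T x :=
  ((hr.strictAnti x hx).lt_iff_gt (hO.mem_right x hx) (hO.mem_left x hx)).1 h

variable [IsProbabilityMeasure (densityLaw xl xh f)]

lemma segregationSet_eq (hO : IsOptimalMatching xl xh yl yh f d S T) :
    segregationSet xl xh (densityLaw xl xh f) S T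
      = {x ∈ Icc xl xh | cumulGap xl xh f S T x = 0} := by
  have hS := integrable_densityLaw (a := xl) (b := xh) (f := f) hO.continuous_left.continuousOn
  have hT := integrable_densityLaw (a := xl) (b := xh) (f := f) hO.continuous_right.continuousOn
  ext x
  simp only [segregationSet, cumulGap, integral_sub hT.integrableOn hS.integrableOn, sub_eq_zero]

lemma compressionSet_eq (hO : IsOptimalMatching xl xh yl yh f d S T) :
    compressionSet xl xh (densityLaw xl xh f) S T
      = {x ∈ Icc xl xh | 0 < cumulGap xl xh f S T x} := by
  have hS := integrable_densityLaw (a := xl) (b := xh) (f := f) hO.continuous_left.continuousOn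
  have hT := integrable_densityLaw (a := xl) (b := xh) (f := f) hO.continuous_right.continuousOn
  ext x
  simp only [compressionSet, cumulGap, integral_sub hT.integrableOn hS.integrableOn, sub_pos]

/-- Otherwise `m_S x < m_S x₀ = m_T x₀ ≤ m_T x` for every `x` in `(x₀, xh)`, so `T < S` there and
the gap ends below zero. -/
lemma exists_right (hr : IsRegularValue xl xh yl yh v d K) (hf : IsPosContDensity xl xh f)
    (hO : IsOptimalMatching xl xh yl yh f d S T) {x₀ : ℝ} (hx₀ : x₀ ∈ Ioo xl xh)
    (h : cumulGap xl xh f S T x₀ = 0) :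
    ∃ x ∈ Ioo x₀ xh, d x₀ (S x₀) ≤ d x (S x) := by
  by_contra! hn
  have := hO.lt_gap hf hx₀.1.le hx₀.2 le_rfl fun x hx => by
    have hxX : x ∈ Icc xl xh := ⟨(hx₀.1.trans hx.1).le, hx.2.le⟩
    refine hO.right_lt_left hr hxX ((hn x hx).trans_le ?_)
    rw [← hO.eq_of_gap_eq_zero hf hx₀ h]
    exact hO.monotone (Ioo_subset_Icc_self hx₀) hxX hx.1.le
  rw [h, hO.gap_top] at this
  exact lt_irrefl _ this

lemma exists_left (hr : IsRegularValue xl xh yl yh v d K) (hf : IsPosContDensity xl xh f)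
    (hO : IsOptimalMatching xl xh yl yh f d S T) {x₀ : ℝ} (hx₀ : x₀ ∈ Ioo xl xh)
    (h : cumulGap xl xh f S T x₀ = 0) :
    ∃ x ∈ Ioo xl x₀, d x (S x) ≤ d x₀ (S x₀) := by
  by_contra! hn
  have := hO.gap_lt hf le_rfl hx₀.1 hx₀.2.le fun x hx => by
    have hxX : x ∈ Icc xl xh := ⟨hx.1.le, (hx.2.trans hx₀.2).le⟩
    refine hO.left_lt_right hr hxX (lt_of_le_of_lt ?_ (hn x hx))
    rw [← hO.eq_of_gap_eq_zero hf hx₀ h]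
    exact hO.monotone hxX (Ioo_subset_Icc_self hx₀) hx.2.le
  rw [h, cumulGap_left] at this
  exact lt_irrefl _ this

lemma deriv_eq_of_Ioo (hx : xl < xh) (hr : IsRegularValue xl xh yl yh v d K)
    (hO : IsOptimalMatching xl xh yl yh f d S T) {s t : ℝ} (hs : xl ≤ s) (ht : t ≤ xh)
    (hpos : ∀ u ∈ Ioo s t, 0 < cumulGap xl xh f S T u) {u : ℝ} (hu : u ∈ Ioo s t) :
    d u (T u) = d s (T s) ∧ d u (T u) = d t (T t) := by
  have hst : s < t := hu.1.trans hu.2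
  have hsub : Icc s t ⊆ Icc xl xh := Icc_subset_Icc hs ht
  have hconst : ∀ w ∈ Ioo s t, d w (T w) = d u (T u) := fun w hw => by
    rcases le_total w u with h | h
    · exact hO.deriv_eq hx (hsub (Ioo_subset_Icc_self hw)) (hsub (Ioo_subset_Icc_self hu)) h
        fun c hc => hpos c ⟨hw.1.trans_le hc.1, hc.2.trans_lt hu.2⟩
    · exact (hO.deriv_eq hx (hsub (Ioo_subset_Icc_self hu)) (hsub (Ioo_subset_Icc_self hw)) h
        fun c hc => hpos c ⟨hu.1.trans_le hc.1, hc.2.trans_lt hw.2⟩).symm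
  have hE : EqOn (fun w => d w (T w)) (fun _ => d u (T u)) (Icc s t) := by
    refine EqOn.of_subset_closure (s := Ioo s t) hconst
      ((hO.continuousOn_deriv hr).mono hsub) continuousOn_const Ioo_subset_Icc_self ?_
    rw [closure_Ioo hst.ne]
  exact ⟨(hE (left_mem_Icc.2 hst.le)).symm, (hE (right_mem_Icc.2 hst.le)).symm⟩

/-- On a positive excursion `(s, t)`, `m_T` is constant and equals `m_S t`, which exceeds `m_S u`.
So `T < S` throughout, and the gap could not return to its starting value. -/
lemma gap_eq_zero_of_strictMonoOn_left (hx : xl < xh) (hr : IsRegularValue xl xh yl yh v d K)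
    (hf : IsPosContDensity xl xh f) (hO : IsOptimalMatching xl xh yl yh f d S T) {x₀ : ℝ}
    (hx₀ : x₀ ∈ Ioo xl xh) (h : cumulGap xl xh f S T x₀ = 0)
    (hm : StrictMonoOn (fun x => d x (S x)) (Icc xl x₀)) :
    ∀ x ∈ Icc xl x₀, cumulGap xl xh f S T x = 0 := by
  have hsub : Icc xl x₀ ⊆ Icc xl xh := Icc_subset_Icc_right hx₀.2.le
  intro x hxx
  by_contra hne
  obtain ⟨s, hs, t, ht, hs0, ht0, hpos⟩ := exists_excursion (hO.continuousOn_gap.mono hsub)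
    (fun t ht => hO.gap_nonneg t (hsub ht)) cumulGap_left h hxx
    (lt_of_le_of_ne (hO.gap_nonneg x (hsub hxx)) (Ne.symm hne))
  have hst : s < t := hs.2.trans ht.1
  have htX : t ∈ Ioo xl xh := ⟨hs.1.trans_lt hst, ht.2.trans_lt hx₀.2⟩
  have := hO.lt_gap hf hs.1 hst htX.2.le fun u hu => by
    have huI : u ∈ Icc xl x₀ := ⟨hs.1.trans hu.1.le, hu.2.le.trans ht.2⟩
    refine hO.right_lt_left hr (hsub huI) ?_
    rw [(hO.deriv_eq_of_Ioo hx hr hs.1 htX.2.le hpos hu).2, hO.eq_of_gap_eq_zero hf htX ht0]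
    exact hm huI ⟨htX.1.le, ht.2⟩ hu.2
  rw [hs0, ht0] at this
  exact lt_irrefl _ this

lemma gap_eq_zero_of_strictMonoOn_right (hx : xl < xh) (hr : IsRegularValue xl xh yl yh v d K)
    (hf : IsPosContDensity xl xh f) (hO : IsOptimalMatching xl xh yl yh f d S T) {x₀ : ℝ}
    (hx₀ : x₀ ∈ Ioo xl xh) (h : cumulGap xl xh f S T x₀ = 0)
    (hm : StrictMonoOn (fun x => d x (S x)) (Icc x₀ xh)) :
    ∀ x ∈ Icc x₀ xh, cumulGap xl xh f S T x = 0 := by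
  have hsub : Icc x₀ xh ⊆ Icc xl xh := Icc_subset_Icc_left hx₀.1.le
  intro x hxx
  by_contra hne
  obtain ⟨s, hs, t, ht, hs0, ht0, hpos⟩ := exists_excursion (hO.continuousOn_gap.mono hsub)
    (fun t ht => hO.gap_nonneg t (hsub ht)) h hO.gap_top hxx
    (lt_of_le_of_ne (hO.gap_nonneg x (hsub hxx)) (Ne.symm hne))
  have hst : s < t := hs.2.trans ht.1
  have hsX : s ∈ Ioo xl xh := ⟨hx₀.1.trans_le hs.1, hst.trans_le ht.2⟩
  have := hO.gap_lt hf hsX.1.le hst ht.2 fun u hu => by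
    have huI : u ∈ Icc x₀ xh := ⟨hs.1.trans hu.1.le, hu.2.le.trans ht.2⟩
    refine hO.left_lt_right hr (hsub huI) ?_
    rw [(hO.deriv_eq_of_Ioo hx hr hsX.1.le ht.2 hpos hu).1, hO.eq_of_gap_eq_zero hf hsX hs0]
    exact hm ⟨hs.1, hsX.2.le⟩ huI hu.1
  rw [hs0, ht0] at this
  exact lt_irrefl _ this

lemma isPAS_iff (hx : xl < xh) (hr : IsRegularValue xl xh yl yh v d K)
    (hf : IsPosContDensity xl xh f) (hO : IsOptimalMatching xl xh yl yh f d S T) :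
    IsPAS xl xh (densityLaw xl xh f) S T ↔ MonotoneOn (fun x => d x (S x)) (Icc xl xh) := by
  have hSc := hO.continuous_left
  have hTc := hO.continuous_right
  rw [IsPAS, hO.segregationSet_eq]
  constructor
  · intro h
    have h0 : ∀ x ∈ Icc xl xh, cumulGap xl xh f S T x = 0 := fun x hxX => by
      rw [← h] at hxX
      exact hxX.2
    have hE : EqOn T S (Icc xl xh) := by
      rw [← closure_Ioo hx.ne]
      exact EqOn.closure (fun x hxI => hO.eq_of_gap_eq_zero hf hxI (h0 x (Ioo_subset_Icc_self hxI)))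
        hTc hSc
    refine hO.monotone.congr fun x hxX => ?_
    simp only [hE hxX]
  · intro hm
    have hdS : ContinuousOn (fun x => d x (S x)) (Icc xl xh) :=
      hr.continuousOn_deriv.comp (f := fun x => (x, S x)) (by fun_prop)
        fun x hx => ⟨hx, hO.mem_left x hx⟩
    have hD : ContinuousOn (fun x => T x - S x) (Icc xl xh) := (hTc.sub hSc).continuousOn
    have i1 := integrable_densityLaw (f := f) ((hO.continuousOn_deriv hr).mul hD)
    have i2 := integrable_densityLaw (f := f) (hdS.mul hD)
    have h1 := hO.integral_mul_le hx hm (left_mem_Icc.2 hx.le) (left_mem_Icc.2 hx.le) le_rfl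
      (σ := 0) fun c hc => hO.gap_nonneg c ⟨hc.1, hc.2.trans hx.le⟩
    rw [neg_zero, zero_mul] at h1
    -- The product `(m_S - m_T)(T - S)` is positive wherever `T ≠ S`, yet its integral is at most
    -- zero.
    have hsign : ∀ x ∈ Icc xl xh, (d x (S x) * (T x - S x) - d x (T x) * (T x - S x)) ≥ 0 ∧
        (d x (S x) * (T x - S x) - d x (T x) * (T x - S x) = 0 → T x - S x = 0) := by
      intro x hxX
      rw [← sub_mul]
      rcases lt_trichotomy (T x) (S x) with hlt | he | hgt
      · have := hr.strictAnti x hxX (hO.mem_right x hxX) (hO.mem_left x hxX) hlt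
        have h2 := mul_pos_of_neg_of_neg (sub_neg.2 this) (sub_neg.2 hlt)
        exact ⟨h2.le, fun h => absurd h h2.ne'⟩
      · simp [he]
      · have := hr.strictAnti x hxX (hO.mem_left x hxX) (hO.mem_right x hxX) hgt
        have h2 := mul_pos (sub_pos.2 this) (sub_pos.2 hgt)
        exact ⟨h2.le, fun h => absurd h h2.ne'⟩
    have hnn : 0 ≤ᵐ[densityLaw xl xh f]
        fun x => d x (S x) * (T x - S x) - d x (T x) * (T x - S x) := by
      filter_upwards [ae_mem_densityLaw] with x hxX using (hsign x hxX).1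
    have h3 : ∫ x, (d x (S x) * (T x - S x) - d x (T x) * (T x - S x)) ∂densityLaw xl xh f
        = ∫ x, d x (S x) * (T x - S x) ∂densityLaw xl xh f
          - ∫ x, d x (T x) * (T x - S x) ∂densityLaw xl xh f := integral_sub i2 i1
    have h4 := (integral_eq_zero_iff_of_nonneg_ae hnn (i2.sub i1)).1
      (le_antisymm (by linarith [hO.integral_nonneg]) (integral_nonneg_of_ae hnn))
    have h5 : (fun x => T x - S x) =ᵐ[densityLaw xl xh f] 0 := by
      filter_upwards [h4, ae_mem_densityLaw] with x hx1 hxX using (hsign x hxX).2 hx1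
    refine Subset.antisymm (fun x hxX => hxX.1) fun x hxX => ⟨hxX, ?_⟩
    rw [cumulGap, integral_congr_ae (ae_restrict_of_ae h5)]
    simp

lemma isFullCompression (hr : IsRegularValue xl xh yl yh v d K)
    (hf : IsPosContDensity xl xh f) (hO : IsOptimalMatching xl xh yl yh f d S T)
    (hm : StrictAntiOn (fun x => d x (S x)) (Icc xl xh)) :
    IsFullCompression xl xh (densityLaw xl xh f) S T := by
  rw [IsFullCompression, hO.compressionSet_eq]
  refine Subset.antisymm (fun x hx => ?_) fun x hx => ?_
  · obtain ⟨hxX, hpos⟩ := hx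
    refine ⟨lt_of_le_of_ne hxX.1 fun h => ?_, lt_of_le_of_ne hxX.2 fun h => ?_⟩
    · rw [← h, cumulGap_left] at hpos
      exact lt_irrefl _ hpos
    · rw [h, hO.gap_top] at hpos
      exact lt_irrefl _ hpos
  · have hxX := Ioo_subset_Icc_self hx
    refine ⟨hxX, lt_of_le_of_ne (hO.gap_nonneg x hxX) fun h => ?_⟩
    obtain ⟨w, hw, hle⟩ := hO.exists_right hr hf hx h.symm
    exact absurd (hm hxX ⟨(hx.1.trans hw.1).le, hw.2.le⟩ hw.1) (not_lt.2 hle)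

lemma isUpperCompression (hx : xl < xh) (hr : IsRegularValue xl xh yl yh v d K)
    (hf : IsPosContDensity xl xh f) (hO : IsOptimalMatching xl xh yl yh f d S T)
    (hm : StrictQuasiconcave (Icc xl xh) (fun x => d x (S x))) :
    IsUpperCompression xl xh (densityLaw xl xh f) S T := by
  have hclaim : ∀ x₀ ∈ Ico xl xh, cumulGap xl xh f S T x₀ = 0 →
      ∀ x ∈ Icc xl x₀, cumulGap xl xh f S T x = 0 := by
    intro x₀ hx₀ h x hxx
    rcases eq_or_lt_of_le hx₀.1 with he | hlt
    · rw [← he] at hxx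
      rw [le_antisymm hxx.2 hxx.1, cumulGap_left]
    obtain ⟨w, hw, hle⟩ := hO.exists_right hr hf ⟨hlt, hx₀.2⟩ h
    exact hO.gap_eq_zero_of_strictMonoOn_left hx hr hf ⟨hlt, hx₀.2⟩ h
      (hm.strictMonoOn ordConnected_Icc (left_mem_Icc.2 hx.le)
        ⟨hx₀.1.trans hw.1.le, hw.2.le⟩ hw.1 hle) x hxx
  -- The cutoff is the last zero of the gap. The right end is left out of `Z` because the gap always
  -- vanishes there; a supremum equal to `xh` makes the compression interval empty.
  set Z : Set ℝ := {x ∈ Ico xl xh | cumulGap xl xh f S T x = 0}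
  have hne : Z.Nonempty := ⟨xl, ⟨le_rfl, hx⟩, cumulGap_left⟩
  have hbdd : BddAbove Z := ⟨xh, fun x hxZ => hxZ.1.2.le⟩
  have hcl : IsClosed (Icc xl xh ∩ cumulGap xl xh f S T ⁻¹' {0}) :=
    hO.continuousOn_gap.preimage_isClosed_of_isClosed isClosed_Icc isClosed_singleton
  have hZsub : Z ⊆ Icc xl xh ∩ cumulGap xl xh f S T ⁻¹' {0} :=
    fun x hxZ => ⟨Ico_subset_Icc_self hxZ.1, hxZ.2⟩
  obtain ⟨hcX, hc0⟩ := closure_minimal hZsub hcl (csSup_mem_closure hne hbdd)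
  refine ⟨sSup Z, hcX, ?_⟩
  rw [hO.compressionSet_eq]
  refine Subset.antisymm (fun x hxx => ?_) fun x hxx => ?_
  · obtain ⟨hxX, hpos⟩ := hxx
    refine ⟨?_, lt_of_le_of_ne hxX.2 fun h => ?_⟩
    · by_contra! hle
      rcases eq_or_lt_of_le hle with he | hlt
      · rw [he] at hpos
        exact hpos.ne' hc0
      · obtain ⟨z, hz, hxz⟩ := exists_lt_of_lt_csSup hne hlt
        exact hpos.ne' (hclaim z hz.1 hz.2 x ⟨hxX.1, hxz.le⟩)
    · rw [h, hO.gap_top] at hpos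
      exact lt_irrefl _ hpos
  · have hxX : x ∈ Icc xl xh := ⟨hcX.1.trans hxx.1.le, hxx.2.le⟩
    refine ⟨hxX, lt_of_le_of_ne (hO.gap_nonneg x hxX) fun h => ?_⟩
    exact absurd (le_csSup hbdd (show x ∈ Z from ⟨⟨hxX.1, hxx.2⟩, h.symm⟩)) (not_le.2 hxx.1)

lemma isLowerCompression (hx : xl < xh) (hr : IsRegularValue xl xh yl yh v d K)
    (hf : IsPosContDensity xl xh f) (hO : IsOptimalMatching xl xh yl yh f d S T)
    (hm : StrictQuasiconvex (Icc xl xh) (fun x => d x (S x))) :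
    IsLowerCompression xl xh (densityLaw xl xh f) S T := by
  have hclaim : ∀ x₀ ∈ Ioc xl xh, cumulGap xl xh f S T x₀ = 0 →
      ∀ x ∈ Icc x₀ xh, cumulGap xl xh f S T x = 0 := by
    intro x₀ hx₀ h x hxx
    rcases eq_or_lt_of_le hx₀.2 with he | hlt
    · rw [he] at hxx
      rw [le_antisymm hxx.2 hxx.1, hO.gap_top]
    obtain ⟨w, hw, hle⟩ := hO.exists_left hr hf ⟨hx₀.1, hlt⟩ h
    exact hO.gap_eq_zero_of_strictMonoOn_right hx hr hf ⟨hx₀.1, hlt⟩ h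
      (hm.strictMonoOn ordConnected_Icc ⟨hw.1.le, hw.2.le.trans hx₀.2⟩
        (right_mem_Icc.2 hx.le) hw.2 hle) x hxx
  set Z : Set ℝ := {x ∈ Ioc xl xh | cumulGap xl xh f S T x = 0}
  have hne : Z.Nonempty := ⟨xh, ⟨hx, le_rfl⟩, hO.gap_top⟩
  have hbdd : BddBelow Z := ⟨xl, fun x hxZ => hxZ.1.1.le⟩
  have hcl : IsClosed (Icc xl xh ∩ cumulGap xl xh f S T ⁻¹' {0}) :=
    hO.continuousOn_gap.preimage_isClosed_of_isClosed isClosed_Icc isClosed_singleton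
  have hZsub : Z ⊆ Icc xl xh ∩ cumulGap xl xh f S T ⁻¹' {0} :=
    fun x hxZ => ⟨Ioc_subset_Icc_self hxZ.1, hxZ.2⟩
  obtain ⟨hcX, hc0⟩ := closure_minimal hZsub hcl (csInf_mem_closure hne hbdd)
  refine ⟨sInf Z, hcX, ?_⟩
  rw [hO.compressionSet_eq]
  refine Subset.antisymm (fun x hxx => ?_) fun x hxx => ?_
  · obtain ⟨hxX, hpos⟩ := hxx
    refine ⟨lt_of_le_of_ne hxX.1 fun h => ?_, ?_⟩
    · rw [← h, cumulGap_left] at hpos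
      exact lt_irrefl _ hpos
    · by_contra! hle
      rcases eq_or_lt_of_le hle with he | hlt
      · rw [← he] at hpos
        exact hpos.ne' hc0
      · obtain ⟨z, hz, hxz⟩ := exists_lt_of_csInf_lt hne hlt
        exact hpos.ne' (hclaim z hz.1 hz.2 x ⟨hxz.le, hxX.2⟩)
  · have hxX : x ∈ Icc xl xh := ⟨hxx.1.le, hxx.2.le.trans hcX.2⟩
    refine ⟨hxX, lt_of_le_of_ne (hO.gap_nonneg x hxX) fun h => ?_⟩
    exact absurd (csInf_le hbdd (show x ∈ Z from ⟨⟨hxx.1, hxX.2⟩, h.symm⟩)) (not_le.2 hxx.2)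

end IsOptimalMatching

end Shape

end PeerMatching

/-! ### The main theorem. -/

theorem mainTheorem5 (xl xh yl yh : ℝ) (hx : xl < xh) (hy : yl < yh)
    (f g : ℝ → ℝ) (hf : PeerMatching.IsPosContDensity xl xh f)
    (hg : PeerMatching.IsPosContDensity yl yh g)
    (μ ν : MeasureTheory.Measure ℝ)
    (hμ : μ = PeerMatching.densityLaw xl xh f) (hν : ν = PeerMatching.densityLaw yl yh g)
    (v : ℝ → ℝ → ℝ)
    (hv : ContDiffOn ℝ 2 (fun w : ℝ × ℝ => v w.1 w.2) (Set.Icc xl xh ×ˢ Set.Icc yl yh))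
    (hxz : ∀ x ∈ Set.Icc xl xh, ∀ z ∈ Set.Icc yl yh,
      0 < PeerMatching.partialXZ xl xh yl yh v x z)
    (hzz : ∀ x ∈ Set.Icc xl xh, ∀ z ∈ Set.Icc yl yh,
      PeerMatching.partialZZ yl yh v x z < 0)
    (S : ℝ → ℝ) (hS : S = PeerMatching.quantileMatching yl yh μ ν)
    (m : ℝ → ℝ) (hm : m = fun x => PeerMatching.partialZ yl yh v x (S x)) :
    ∃ T : ℝ → ℝ, PeerMatching.IsEquilibriumMatching xl xh yl yh μ ν v T ∧
      (∀ T' : ℝ → ℝ, PeerMatching.IsEquilibriumMatching xl xh yl yh μ ν v T' →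
        Set.EqOn T' T (Set.Icc xl xh)) ∧
      (PeerMatching.IsPAS xl xh μ S T ↔ MonotoneOn m (Set.Icc xl xh)) ∧
      (StrictAntiOn m (Set.Icc xl xh) → PeerMatching.IsFullCompression xl xh μ S T) ∧
      (PeerMatching.StrictQuasiconcave (Set.Icc xl xh) m →
        PeerMatching.IsUpperCompression xl xh μ S T) ∧
      (PeerMatching.StrictQuasiconvex (Set.Icc xl xh) m →
        PeerMatching.IsLowerCompression xl xh μ S T) := by
  subst hμ hν
  have := hf.isProbabilityMeasure hx
  have := hg.isProbabilityMeasure hy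
  have hμ := PeerMatching.ae_mem_densityLaw (a := xl) (b := xh) (f := f)
  have hν := PeerMatching.ae_mem_densityLaw (a := yl) (b := yh) (f := g)
  obtain ⟨K, hr⟩ := PeerMatching.exists_isRegularValue hx hy hv hxz hzz
  obtain ⟨q, T, hq, hqK, hTc, hT, hqT, hmaj⟩ := PeerMatching.exists_wages hr hx hy hμ hν
  have hE := PeerMatching.isCompetitiveEquilibrium_map hr hμ hq hqK hTc hT hqT hmaj
  have hSY : ∀ x, S x ∈ Icc yl yh := fun x => by
    rw [hS]; exact (PeerMatching.quantileMatching_spec hg hy x).1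
  have hSc : Continuous S := by
    rw [hS]; exact PeerMatching.continuous_quantileMatching hg hy
  have hSm : StrictMonoOn S (Icc xl xh) := by
    rw [hS]; exact PeerMatching.strictMonoOn_quantileMatching hf hg hy
  have hSν : (PeerMatching.densityLaw xl xh f).map S = PeerMatching.densityLaw yl yh g := by
    rw [hS]; exact PeerMatching.map_quantileMatching hf hg hx hy
  -- The workers' wage bill becomes that of the matching `S`, the benchmark against which `T` is
  -- compared.
  have hqS : ∫ z, q z ∂PeerMatching.densityLaw yl yh g
      = ∫ x, q (S x) ∂PeerMatching.densityLaw xl xh f := by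
    have h1 := (PeerMatching.integrable_of_continuousOn_Icc hν
      hqK.continuousOn).aestronglyMeasurable
    rw [← hSν] at h1 ⊢
    exact integral_map hSc.aemeasurable h1
  have hO := PeerMatching.isOptimalMatching hr hy hq hqK.continuousOn hTc hT hSc
    (fun x _ => hSY x) hSm (hqT.trans hqS) (by rw [hSν]; exact hmaj)
  have hquant : EqOn T (PeerMatching.quantileMatching yl yh (PeerMatching.densityLaw xl xh f)
      ((PeerMatching.densityLaw xl xh f).map fun x => (x, T x)).snd) (Icc xl xh) := by
    intro x hxX
    rw [Measure.snd, Measure.map_map measurable_snd (by fun_prop)]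
    exact (PeerMatching.quantileMatching_map hf hx hTc (hT.monotoneOn hr)
      (fun x hx => (hT x hx).1) hxX).symm
  subst hm
  refine ⟨T, ⟨_, _, _, hE, hquant⟩, ?_, hO.isPAS_iff hx hr hf, hO.isFullCompression hr hf,
    hO.isUpperCompression hx hr hf, hO.isLowerCompression hx hr hf⟩
  rintro T' ⟨J', p', q', hE', hT'⟩
  rw [hE.eq_map hr hy hν hTc hT hE'] at hT'
  exact hT'.trans hquant.symm
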